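/- **Theorem 5.9 (integer and fractional Hardy inequalities in Morrey spaces on $\mathbb{R}^N$).** For $p>1$, $\lambda>0$ and a measurable (real- or vector-valued) $f$ on $\mathbb{R}^N$ put $$\|f\|_{M^\lambda_p}=\Big(\sup_{x\in\mathbb{R}^N}\sup_{r>0}\,r^{-\lambda}\int_{B(x,r)}|f(y)|^p\,dy\Big)^{1/p},$$ and write $f\in M^\lambda_p$ if $f\in L^p_{loc}(\mathbb{R}^N)$ and $\|f\|_{M^\lambda_p}<\infty$. Here $|x|$ is the Euclidean norm and $1/p+1/p'=1$. In (1) and (2), $u$ ranges over the real functions in $L^1_{loc}(\mathbb{R}^N)$ with weak gradient $\nabla u\in L^1_{loc}(\mathbb{R}^N)$ that vanish at infinity in the mean, i.e. $|B(0,R)|^{-1}\int_{B(0,R)}|u|\,dx\to0$ as $R\to\infty$. In (3) and (4), $u$ ranges over the real Schwartz functions on $\mathbb{R}^N$ and, for $0<s<1$, $$(-\Delta)^s u(x)=\frac{A(N,s)}2\int_{\mathbb{R}^N}\frac{2u(x)-u(x+y)-u(x-y)}{|y|^{N+2s}}\,dy,\qquad A(N,s)=\frac{4^s\,\Gamma(N/2+s)}{\pi^{N/2}\,|\Gamma(-s)|}.$$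 In each part, $C>0$ depends only on $N$ and the listed parameters, not on $u$, and the function on the left belongs to $M^\lambda_p$. 1. Let $1<p<\infty$, $\alpha<\frac N{p'}$, $\beta<\frac{N-\lambda}p$, $\alpha+\beta=1$ and $0<\lambda<\min\{N,N-\beta p\}$. Then for all $u$ with $|\cdot|^\alpha\nabla u\in M^\lambda_p$, $$\Big\|\frac{u}{|x|^\beta}\Big\|_{M^\lambda_p}\le C\,\big\||\cdot|^\alpha\nabla u\big\|_{M^\lambda_p}.$$ 2. In particular ($\alpha=0$), let $1<p<N$ and $0<\lambda<N-p$. Then for all $u$ with $\nabla u\in M^\lambda_p$, $$\Big\|\frac{u}{|x|}\Big\|_{M^\lambda_p}\le C\,\|\nabla u\|_{M^\lambda_p}.$$ 3. Let $1<p<\infty$, $\alpha<\frac N{p'}$, $\beta<\frac{N-\lambda}p$, $\alpha+\beta=\gamma\in(0,1)$ and $0<\lambda<\min\{N,N-\beta p\}$. Then for all $u$ with $|\cdot|^\alpha(-\Delta)^{\gamma/2}u\in M^\lambda_p$, $$\big\||\cdot|^{-\beta}u\big\|_{M^\lambda_p}\le C\,\big\||\cdot|^\alpha(-\Delta)^{\gamma/2}u\big\|_{M^\lambda_p}.$$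 4. In particular ($\alpha=0$), let $p>1$, $\gamma\in(0,1)$, $N>\gamma p$ and $0<\lambda<N-\gamma p$. Then for all $u$ with $(-\Delta)^{\gamma/2}u\in M^\lambda_p$, $$\big\||\cdot|^{-\gamma}u\big\|_{M^\lambda_p}\le C\,\|(-\Delta)^{\gamma/2}u\|_{M^\lambda_p}.$$ -/

import Mathlib

open MeasureTheory Filter Topology Metric
open scoped ENNReal NNReal ContDiff SchwartzMap

noncomputable section

/-- The (extended) norm of the global Morrey space `M^lam_p(ℝ^N)`: the `p`-th root of
`sup_x sup_{r > 0} r^{-lam} ∫_{B(x,r)} |f(y)|^p dy`, with value in `[0, ∞]`. For a vector-valued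
`f`, `|f|` is the norm of the value. -/
def eMorreyNorm {N : ℕ} {F : Type*} [NormedAddCommGroup F] (p lam : ℝ)
    (f : EuclideanSpace ℝ (Fin N) → F) : ℝ≥0∞ :=
  (⨆ (x : EuclideanSpace ℝ (Fin N)) (r : ℝ) (_ : 0 < r),
    ENNReal.ofReal (r ^ (-lam)) * ∫⁻ y in ball x r, ‖f y‖ₑ ^ p) ^ (1 / p)

/-- `f ∈ M^lam_p(ℝ^N)`: `f` is locally in `L^p` and its Morrey norm is finite. -/
structure MemMorrey {N : ℕ} {F : Type*} [NormedAddCommGroup F] (p lam : ℝ)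
    (f : EuclideanSpace ℝ (Fin N) → F) : Prop where
  aestronglyMeasurable : AEStronglyMeasurable f volume
  memLp_compact : ∀ K : Set (EuclideanSpace ℝ (Fin N)), IsCompact K →
    MemLp f (ENNReal.ofReal p) (volume.restrict K)
  norm_lt_top : eMorreyNorm p lam f < ⊤

/-- `g` is the weak (distributional) gradient of the locally integrable function `u` on `ℝ^N`. -/
structure HasWeakGradient {N : ℕ} (u : EuclideanSpace ℝ (Fin N) → ℝ)
    (g : EuclideanSpace ℝ (Fin N) → EuclideanSpace ℝ (Fin N)) : Prop where
  locallyIntegrable : LocallyIntegrable u volume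
  locallyIntegrable_grad : LocallyIntegrable g volume
  integral_eq : ∀ φ : EuclideanSpace ℝ (Fin N) → ℝ, ContDiff ℝ ∞ φ → HasCompactSupport φ →
    ∀ v : EuclideanSpace ℝ (Fin N),
      ∫ x, u x * fderiv ℝ φ x v = -∫ x, inner ℝ (g x) v * φ x

/-- `u` vanishes at infinity in the mean: `|B(0,R)|⁻¹ ∫_{B(0,R)} |u| → 0` as `R → ∞`. -/
def VanishesInMean {N : ℕ} (u : EuclideanSpace ℝ (Fin N) → ℝ) : Prop :=
  Tendsto (fun R : ℝ => ⨍ x in ball (0 : EuclideanSpace ℝ (Fin N)) R, |u x|) atTop (𝓝 0)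

/-- The normalization constant
`A(N,s) = 4^s Γ(N/2 + s) / (π^{N/2} |Γ(-s)|)`, with `|Γ(-s)| = Γ(1 - s) / s` for `0 < s < 1`;
with it `(-Δ)^s` has the symbol `|ξ|^{2s}`. -/
def fracLaplacianConst (N : ℕ) (s : ℝ) : ℝ :=
  4 ^ s * s * Real.Gamma (N / 2 + s) / (Real.pi ^ ((N : ℝ) / 2) * Real.Gamma (1 - s))

/-- The fractional Laplacian `(-Δ)^s`, `0 < s < 1`, as a second-difference integral
(absolutely convergent for Schwartz functions). -/
def fracLaplacian {N : ℕ} (s : ℝ) (u : EuclideanSpace ℝ (Fin N) → ℝ)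
    (x : EuclideanSpace ℝ (Fin N)) : ℝ :=
  fracLaplacianConst N s / 2 *
    ∫ y, (2 * u x - u (x + y) - u (x - y)) / ‖y‖ ^ ((N : ℝ) + 2 * s)

end

open MeasureTheory Filter Topology Metric
open scoped ENNReal NNReal ContDiff SchwartzMap

/-! ### Dyadic annuli and geometric summation. -/

section DyadicAnnuli

/-! All four inequalities rest on one operator bound and two representation formulas. Write `d = N`,
and let `f` be the gradient (`γ = 1`) or the fractional Laplacian of order `γ / 2`. In both cases
`|u|` is at most a constant times the Riesz potential of `|f|`, with kernel `‖x - y‖ ^ (γ - d)`. It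
remains to bound the kernel `‖x‖ ^ (-β) * ‖x - y‖ ^ (γ - d) * ‖y‖ ^ (-α)` on the Morrey space
(`MorreyBound.weightedRieszPotential`). Since `α + β = γ`, it is homogeneous of degree `-d`.

Operator bound: split according to the size of `‖y‖` against `‖x‖`. Where `y` is much smaller or
much larger, the kernel is a Hardy kernel. Hölder's inequality on dyadic annuli leaves geometric
series, and both regions contribute a multiple of `‖x‖ ^ (-(d - lam) / p)`, which lies in the Morrey
space. Where the sizes are comparable, the operator is, on each annulus in `x`, dominated by
convolution with a measure of uniformly bounded mass. Jensen's inequality and the translation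
invariance of the Morrey norm finish that case. No maximal function is needed.

Gradient: the field `z / ‖z‖ ^ N`, cut off between scales `ε` and `R`, has as divergence a
difference of two averaging kernels. Testing the weak gradient against it and letting `R → ∞`
(vanishing mean), then `ε → 0` (Lebesgue points), gives the pointwise bound
`HasWeakGradient.enorm_le_rieszPotential`.

Fractional Laplacian: rotation and scaling show that its symbol is a positive multiple of `‖ξ‖ ^ γ`.
Pairing with Gaussians and integrating over their width yields `‖x‖ ^ (γ - N)` on one side and `‖ξ‖
^ (-γ)` on the Fourier side, where it cancels the symbol. This recovers `u 0`, and translation gives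
the other points. Constants are never evaluated, only their signs matter. -/

theorem ENNReal.tsum_ofReal_geometric {q C : ℝ} (hq : 0 ≤ q) (hq1 : q < 1) (hC : 0 ≤ C) (A : ℝ≥0∞) :
    ∑' k : ℕ, ENNReal.ofReal (C * q ^ k) * A = ENNReal.ofReal ((1 - q)⁻¹ * C) * A := by
  rw [ENNReal.tsum_mul_right, ← ENNReal.ofReal_tsum_of_nonneg (fun k => by positivity)
    ((summable_geometric_of_lt_one hq hq1).mul_left C), tsum_mul_left,
    tsum_geometric_of_lt_one hq hq1, mul_comm C]

variable {E : Type*} [NormedAddCommGroup E]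

/-- The closed annulus `{ρ ≤ ‖y‖ ≤ 2ρ}`. -/
def closedAnnulus (E : Type*) [NormedAddCommGroup E] (ρ : ℝ) : Set E :=
  {y | ρ ≤ ‖y‖ ∧ ‖y‖ ≤ 2 * ρ}

theorem measurableSet_closedAnnulus [MeasurableSpace E] [BorelSpace E] (ρ : ℝ) :
    MeasurableSet (closedAnnulus E ρ) :=
  (isClosed_le continuous_const continuous_norm).measurableSet.inter
    (isClosed_le continuous_norm continuous_const).measurableSet

theorem ball_subset_iUnion_closedAnnulus {R : ℝ} :
    ball (0 : E) R ⊆ {0} ∪ ⋃ k : ℕ, closedAnnulus E (R / 2 ^ (k + 1)) := by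
  intro y hy
  rw [mem_ball_zero_iff] at hy
  rcases eq_or_ne y 0 with rfl | h0
  · simp
  have hy0 : 0 < ‖y‖ := norm_pos_iff.2 h0
  obtain ⟨n, hn, hn'⟩ := exists_nat_pow_near (x := R / ‖y‖) (y := 2)
    (by rw [le_div_iff₀ hy0]; linarith) (by norm_num)
  refine Or.inr (Set.mem_iUnion.2 ⟨n, ?_, ?_⟩)
  · rw [div_lt_iff₀ hy0] at hn'
    rw [div_le_iff₀ (by positivity)]
    linarith
  · rw [le_div_iff₀ hy0] at hn
    rw [pow_succ, mul_div_assoc', le_div_iff₀ (by positivity)]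
    linarith

theorem compl_ball_subset_iUnion_closedAnnulus {R : ℝ} (hR : 0 < R) :
    (ball (0 : E) R)ᶜ ⊆ ⋃ k : ℕ, closedAnnulus E (R * 2 ^ k) := by
  intro y hy
  rw [Set.mem_compl_iff, mem_ball_zero_iff, not_lt] at hy
  obtain ⟨n, hn, hn'⟩ := exists_nat_pow_near (x := ‖y‖ / R) (y := 2)
    (by rw [le_div_iff₀ hR]; linarith) (by norm_num)
  refine Set.mem_iUnion.2 ⟨n, ?_, ?_⟩
  · rw [le_div_iff₀ hR] at hn
    linarith
  · rw [div_lt_iff₀ hR, pow_succ] at hn'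
    linarith

variable [MeasurableSpace E] {μ : Measure E}

/-- Radii `R / 2 ^ (k + 1)` exhaust the ball except for the origin, which is why points must be
null. The bounds `ρ ^ e` sum geometrically at small radii because `e > 0`; the companion for the
complement needs `e < 0`. -/
theorem setLIntegral_ball_le_of_closedAnnulus [NullSingletonClass μ] {h : E → ℝ≥0∞} {A : ℝ≥0∞}
    {e : ℝ} (he : 0 < e)
    (H : ∀ ρ : ℝ, 0 < ρ → ∫⁻ y in closedAnnulus E ρ, h y ∂μ ≤ ENNReal.ofReal (ρ ^ e) * A)
    {R : ℝ} (hR : 0 < R) :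
    ∫⁻ y in ball 0 R, h y ∂μ ≤ ENNReal.ofReal ((1 - 2 ^ (-e))⁻¹ * R ^ e) * A := by
  have hq : (2 : ℝ) ^ (-e) < 1 := Real.rpow_lt_one_of_one_lt_of_neg (by norm_num) (by linarith)
  calc ∫⁻ y in ball 0 R, h y ∂μ
      ≤ ∫⁻ y in {0} ∪ ⋃ k : ℕ, closedAnnulus E (R / 2 ^ (k + 1)), h y ∂μ :=
        lintegral_mono_set ball_subset_iUnion_closedAnnulus
    _ ≤ ∫⁻ y in {0}, h y ∂μ + ∫⁻ y in ⋃ k : ℕ, closedAnnulus E (R / 2 ^ (k + 1)), h y ∂μ :=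
        lintegral_union_le _ _ _
    _ = ∫⁻ y in ⋃ k : ℕ, closedAnnulus E (R / 2 ^ (k + 1)), h y ∂μ := by
        rw [setLIntegral_measure_zero _ _ (measure_singleton _), zero_add]
    _ ≤ ∑' k : ℕ, ∫⁻ y in closedAnnulus E (R / 2 ^ (k + 1)), h y ∂μ := lintegral_iUnion_le _ _
    _ ≤ ∑' k : ℕ, ENNReal.ofReal (R ^ e * (2 ^ (-e)) ^ k) * A := by
        refine ENNReal.tsum_le_tsum fun k => (H _ (by positivity)).trans ?_
        gcongr
        rw [Real.div_rpow hR.le (by positivity), div_eq_mul_inv]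
        gcongr
        rw [← Real.rpow_natCast, ← Real.rpow_natCast, ← Real.rpow_mul (by norm_num),
          ← Real.rpow_mul (by norm_num), ← Real.rpow_neg (by norm_num)]
        -- The annulus has index `k + 1` and the series exponent `k`: a factor `2 ^ (-e) ≤ 1` is
        -- discarded.
        refine Real.rpow_le_rpow_of_exponent_le (by norm_num) ?_
        push_cast
        nlinarith
    _ = _ := ENNReal.tsum_ofReal_geometric (by positivity) hq (by positivity) A

theorem setLIntegral_compl_ball_le_of_closedAnnulus {h : E → ℝ≥0∞} {A : ℝ≥0∞} {e : ℝ} (he : e < 0)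
    (H : ∀ ρ : ℝ, 0 < ρ → ∫⁻ y in closedAnnulus E ρ, h y ∂μ ≤ ENNReal.ofReal (ρ ^ e) * A)
    {R : ℝ} (hR : 0 < R) :
    ∫⁻ y in (ball 0 R)ᶜ, h y ∂μ ≤ ENNReal.ofReal ((1 - 2 ^ e)⁻¹ * R ^ e) * A := by
  have hq : (2 : ℝ) ^ e < 1 := Real.rpow_lt_one_of_one_lt_of_neg (by norm_num) (by linarith)
  calc ∫⁻ y in (ball 0 R)ᶜ, h y ∂μ
      ≤ ∫⁻ y in ⋃ k : ℕ, closedAnnulus E (R * 2 ^ k), h y ∂μ :=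
        lintegral_mono_set (compl_ball_subset_iUnion_closedAnnulus hR)
    _ ≤ ∑' k : ℕ, ∫⁻ y in closedAnnulus E (R * 2 ^ k), h y ∂μ := lintegral_iUnion_le _ _
    _ ≤ ∑' k : ℕ, ENNReal.ofReal (R ^ e * (2 ^ e) ^ k) * A := by
        refine ENNReal.tsum_le_tsum fun k => (H _ (by positivity)).trans ?_
        rw [Real.mul_rpow hR.le (by positivity), ← Real.rpow_natCast, ← Real.rpow_natCast,
          ← Real.rpow_mul (by norm_num), ← Real.rpow_mul (by norm_num), mul_comm e]
    _ = _ := ENNReal.tsum_ofReal_geometric (by positivity) hq (by positivity) A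

theorem rpow_le_of_mem_Icc {ρ t c : ℝ} (hρ : 0 < ρ) (hc : 1 ≤ c) (h1 : ρ / c ≤ t) (h2 : t ≤ c * ρ)
    (a : ℝ) : t ^ a ≤ c ^ |a| * ρ ^ a := by
  have hc0 : 0 < c := by linarith
  have ht : 0 < t := lt_of_lt_of_le (by positivity) h1
  rcases le_total 0 a with ha | ha
  · rw [abs_of_nonneg ha, ← Real.mul_rpow (by positivity) hρ.le]
    exact Real.rpow_le_rpow ht.le h2 ha
  · rw [abs_of_nonpos ha, Real.rpow_neg hc0.le, ← Real.inv_rpow hc0.le,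
      ← Real.mul_rpow (by positivity) hρ.le]
    exact Real.rpow_le_rpow_of_nonpos (by positivity) (by rwa [inv_mul_eq_div]) ha

/-- On an annulus a power weight is comparable with a constant. -/
theorem setLIntegral_closedAnnulus_rpow_mul_le [BorelSpace E] {w : E → ℝ≥0∞} {ρ : ℝ} (hρ : 0 < ρ) (a : ℝ) :
    ∫⁻ y in closedAnnulus E ρ, ENNReal.ofReal (‖y‖ ^ a) * w y ∂μ ≤
      ENNReal.ofReal (2 ^ |a| * ρ ^ a) * ∫⁻ y in closedAnnulus E ρ, w y ∂μ := by
  rw [← lintegral_const_mul' _ _ ENNReal.ofReal_ne_top]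
  refine setLIntegral_mono' (measurableSet_closedAnnulus ρ) fun y hy => ?_
  gcongr
  exact rpow_le_of_mem_Icc hρ (by norm_num) (by linarith [hy.1]) hy.2 a

end DyadicAnnuli

/-! ### Calculus of Morrey bounds for nonnegative functions. -/

section MorreyBound

variable {E : Type*} [NormedAddCommGroup E] [MeasurableSpace E]

/-- `M` is a bound for the Morrey norm with exponents `p`, `lam` of a function of modulus `w`. -/
def MorreyBound (μ : Measure E) (p lam : ℝ) (w : E → ℝ≥0∞) (M : ℝ≥0∞) : Prop :=
  ∀ (x : E) (r : ℝ), 0 < r → ∫⁻ y in ball x r, w y ^ p ∂μ ≤ ENNReal.ofReal (r ^ lam) * M ^ p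

variable {μ : Measure E} {p lam : ℝ} {w v : E → ℝ≥0∞} {M M' : ℝ≥0∞}

theorem MorreyBound.mono (hp : 0 ≤ p) (h : MorreyBound μ p lam w M) (hv : ∀ᵐ x ∂μ, v x ≤ w x) :
    MorreyBound μ p lam v M := fun x r hr => by
  refine le_trans (lintegral_mono_ae (ae_restrict_of_ae ?_)) (h x r hr)
  filter_upwards [hv] with y hy
  gcongr

theorem MorreyBound.const_mul (hp : 0 ≤ p) (h : MorreyBound μ p lam w M) {c : ℝ≥0∞} (hc : c ≠ ⊤) :
    MorreyBound μ p lam (fun x => c * w x) (c * M) := fun x r hr => by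
  simp_rw [ENNReal.mul_rpow_of_nonneg _ _ hp]
  rw [lintegral_const_mul' _ _ (ENNReal.rpow_ne_top_of_nonneg hp hc), mul_left_comm]
  gcongr
  exact h x r hr

/-- A crude substitute for Minkowski: convexity costs `2 ^ (p - 1)`, and majorizing both `M` and
`M'` by `M + M'` costs another 2. -/
theorem MorreyBound.add (hp : 1 ≤ p) (hw : AEMeasurable w μ) (h : MorreyBound μ p lam w M)
    (h' : MorreyBound μ p lam v M') :
    MorreyBound μ p lam (fun x => w x + v x) (2 * (M + M')) := fun x r hr => by
  have hp0 : 0 ≤ p := by linarith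
  calc ∫⁻ y in ball x r, (w y + v y) ^ p ∂μ
      ≤ ∫⁻ y in ball x r, 2 ^ (p - 1) * (w y ^ p + v y ^ p) ∂μ :=
        lintegral_mono fun y => ENNReal.rpow_add_le_mul_rpow_add_rpow _ _ hp
    _ = 2 ^ (p - 1) * (∫⁻ y in ball x r, w y ^ p ∂μ + ∫⁻ y in ball x r, v y ^ p ∂μ) := by
        rw [lintegral_const_mul' _ _ (ENNReal.rpow_ne_top_of_nonneg (by linarith) (by simp)),
          lintegral_add_left' (hw.restrict.pow_const p)]
    _ ≤ 2 ^ (p - 1) * (ENNReal.ofReal (r ^ lam) * (M + M') ^ p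
          + ENNReal.ofReal (r ^ lam) * (M + M') ^ p) := by
        gcongr
        · exact (h x r hr).trans (by gcongr; exact le_self_add)
        · exact (h' x r hr).trans (by gcongr; exact le_add_self)
    _ = ENNReal.ofReal (r ^ lam) * (2 * (M + M')) ^ p := by
        rw [ENNReal.mul_rpow_of_nonneg _ _ hp0, ← two_mul,
          show (2 : ℝ≥0∞) ^ p = 2 ^ (p - 1) * 2 by
            conv_rhs => rw [← ENNReal.rpow_one 2, ← ENNReal.rpow_mul, one_mul]
            rw [← ENNReal.rpow_add _ _ (by simp) (by simp)]; simp]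
        ring

/-- It suffices to bound the pieces of balls in annuli. -/
theorem MorreyBound.of_annuli [NullSingletonClass μ] (hp : 0 < p) (hlam : 0 < lam) :
    ∃ C : ℝ≥0, ∀ (v : E → ℝ≥0∞) (A : ℝ≥0∞),
      (∀ (a r : ℝ) (c : E), 0 < a → 0 < r →
        ∫⁻ y in ball c r ∩ {x | a ≤ ‖x‖ ∧ ‖x‖ ≤ 4 * a}, v y ^ p ∂μ ≤
          ENNReal.ofReal (r ^ lam) * A ^ p) →
      MorreyBound μ p lam v (C * A) := by
  set K : ℝ := (1 - 2 ^ (-lam))⁻¹ * 3 ^ lam * 3 ^ lam with hK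
  have hK0 : 0 ≤ (1 - (2 : ℝ) ^ (-lam))⁻¹ := by
    have : (2 : ℝ) ^ (-lam) < 1 := Real.rpow_lt_one_of_one_lt_of_neg (by norm_num) (by linarith)
    exact inv_nonneg.2 (by linarith)
  refine ⟨max 1 (K.toNNReal ^ (1 / p)), fun v A H c r hr => ?_⟩
  -- A ball far from the origin relative to its radius lies in one annulus. Any other ball lies in
  -- `ball 0 (3 * r)`, whose dyadic pieces sum because `lam > 0`.
  rcases le_or_gt (2 * r) ‖c‖ with hc | hc
  · calc ∫⁻ y in ball c r, v y ^ p ∂μ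
        ≤ ∫⁻ y in ball c r ∩ {x | ‖c‖ / 2 ≤ ‖x‖ ∧ ‖x‖ ≤ 4 * (‖c‖ / 2)}, v y ^ p ∂μ := by
          refine lintegral_mono_set fun y hy => ⟨hy, ?_⟩
          rw [mem_ball_iff_norm] at hy
          have h1 := norm_sub_norm_le c y
          have h2 := norm_sub_norm_le y c
          rw [norm_sub_rev] at h1
          constructor <;> linarith
      _ ≤ ENNReal.ofReal (r ^ lam) * (1 * A) ^ p := by
          rw [one_mul]; exact H _ _ _ (by linarith) hr
      _ ≤ _ := by
          gcongr
          exact_mod_cast le_max_left _ _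
  · calc ∫⁻ y in ball c r, v y ^ p ∂μ
        ≤ ∫⁻ y in ball 0 (3 * r), v y ^ p ∂μ := by
          refine lintegral_mono_set fun y hy => ?_
          rw [mem_ball_iff_norm] at hy
          rw [mem_ball_zero_iff]
          have h2 := norm_sub_norm_le y c
          linarith
      _ ≤ ENNReal.ofReal ((1 - 2 ^ (-lam))⁻¹ * (3 * r) ^ lam) *
            (ENNReal.ofReal (3 ^ lam) * A ^ p) := by
          refine setLIntegral_ball_le_of_closedAnnulus hlam (fun ρ hρ => ?_) (by positivity)
          rw [← mul_assoc, ← ENNReal.ofReal_mul (by positivity), mul_comm (ρ ^ lam),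
            ← Real.mul_rpow (by norm_num) hρ.le]
          refine le_trans (lintegral_mono_set fun y hy => ?_) (H ρ (3 * ρ) 0 hρ (by positivity))
          refine ⟨?_, hy.1, ?_⟩
          · rw [mem_ball_zero_iff]; linarith [hy.2]
          · linarith [hy.2]
      _ = ENNReal.ofReal (r ^ lam) * (ENNReal.ofReal K * A ^ p) := by
          rw [← mul_assoc, ← mul_assoc, ← ENNReal.ofReal_mul (by positivity),
            ← ENNReal.ofReal_mul (by positivity), Real.mul_rpow (by norm_num) hr.le, hK]
          ring_nf
      _ = ENNReal.ofReal (r ^ lam) * (((K.toNNReal ^ (1 / p) : ℝ≥0) : ℝ≥0∞) * A) ^ p := by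
          rw [ENNReal.mul_rpow_of_nonneg _ _ hp.le, ← ENNReal.coe_rpow_of_nonneg _ hp.le,
            ← NNReal.rpow_mul, one_div_mul_cancel hp.ne', NNReal.rpow_one]
          rfl
      _ ≤ _ := by
          gcongr
          exact le_max_right _ _

end MorreyBound

/-! ### Power weights against Morrey functions. -/

section MorreyPower

variable {E : Type*} [NormedAddCommGroup E] [NormedSpace ℝ E] [FiniteDimensional ℝ E]
  [Nontrivial E] [MeasurableSpace E] [BorelSpace E] {μ : Measure E} [μ.IsAddHaarMeasure]
  {p lam : ℝ}

theorem addHaar_ball_rpow (x : E) {r : ℝ} (hr : 0 < r) :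
    μ (ball x r) = ENNReal.ofReal (r ^ (Module.finrank ℝ E : ℝ)) * μ (ball 0 1) := by
  rw [Measure.addHaar_ball μ x hr.le, Real.rpow_natCast]

/-- Hölder's inequality on balls. -/
theorem MorreyBound.setLIntegral_ball_le (hp : 1 < p) :
    ∃ C : ℝ≥0, ∀ (w : E → ℝ≥0∞) (M : ℝ≥0∞), Measurable w → MorreyBound μ p lam w M →
      ∀ (x : E) (r : ℝ), 0 < r → ∫⁻ y in ball x r, w y ∂μ ≤
        ENNReal.ofReal (r ^ ((Module.finrank ℝ E : ℝ) - (Module.finrank ℝ E - lam) / p)) *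
          (C * M) := by
  have hpq : p.HolderConjugate p.conjExponent := Real.HolderConjugate.conjExponent hp
  set q := p.conjExponent
  have hq := hpq.symm.pos
  have hp0 : 0 < p := by linarith
  refine ⟨((μ (ball (0 : E) 1)) ^ (1 / q)).toNNReal, fun w M hw h x r hr => ?_⟩
  rw [ENNReal.coe_toNNReal (ENNReal.rpow_ne_top_of_nonneg (by positivity) measure_ball_lt_top.ne)]
  calc ∫⁻ y in ball x r, w y ∂μ
      = ∫⁻ y in ball x r, (w * fun _ : E => (1 : ℝ≥0∞)) y ∂μ := by simp
    _ ≤ (∫⁻ y in ball x r, w y ^ p ∂μ) ^ (1 / p) * (∫⁻ y in ball x r, 1 ^ q ∂μ) ^ (1 / q) :=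
        ENNReal.lintegral_mul_le_Lp_mul_Lq _ hpq hw.aemeasurable aemeasurable_const
    _ ≤ (ENNReal.ofReal (r ^ lam) * M ^ p) ^ (1 / p) *
          (ENNReal.ofReal (r ^ (Module.finrank ℝ E : ℝ)) * μ (ball 0 1)) ^ (1 / q) := by
        simp only [ENNReal.one_rpow, lintegral_const, one_mul, Measure.restrict_apply_univ]
        rw [addHaar_ball_rpow x hr]
        gcongr
        exact h x r hr
    _ = _ := by
        rw [ENNReal.mul_rpow_of_nonneg _ _ (by positivity),
          ENNReal.mul_rpow_of_nonneg _ _ (by positivity), ← ENNReal.rpow_mul,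
          mul_one_div_cancel hp0.ne', ENNReal.rpow_one,
          ENNReal.ofReal_rpow_of_nonneg (by positivity) (by positivity),
          ENNReal.ofReal_rpow_of_nonneg (by positivity) (by positivity),
          ← Real.rpow_mul hr.le, ← Real.rpow_mul hr.le]
        have e : (Module.finrank ℝ E : ℝ) - (Module.finrank ℝ E - lam) / p
            = lam * (1 / p) + Module.finrank ℝ E * (1 / q) := by
          have := hpq.inv_add_inv_eq_one
          rw [one_div, one_div, eq_sub_of_add_eq' this]
          ring
        rw [e, Real.rpow_add hr, ENNReal.ofReal_mul (by positivity)]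
        ring

/-- Hölder gives the power `d - (d - lam) / p` of the radius and the weight adds `a`. The sign of
the total decides whether the annuli sum towards the origin or towards infinity. -/
theorem MorreyBound.setLIntegral_closedAnnulus_le (hp : 1 < p) (a : ℝ) :
    ∃ C : ℝ≥0, ∀ (w : E → ℝ≥0∞) (M : ℝ≥0∞), Measurable w → MorreyBound μ p lam w M →
      ∀ ρ : ℝ, 0 < ρ → ∫⁻ y in closedAnnulus E ρ, ENNReal.ofReal (‖y‖ ^ a) * w y ∂μ ≤
        ENNReal.ofReal (ρ ^ (a + ((Module.finrank ℝ E : ℝ) - (Module.finrank ℝ E - lam) / p))) *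
          (C * M) := by
  obtain ⟨C, hC⟩ := MorreyBound.setLIntegral_ball_le (E := E) (μ := μ) (lam := lam) hp
  set e := (Module.finrank ℝ E : ℝ) - (Module.finrank ℝ E - lam) / p
  refine ⟨(2 ^ |a| * 3 ^ e) * C, fun w M hw h ρ hρ => ?_⟩
  calc _ ≤ ENNReal.ofReal (2 ^ |a| * ρ ^ a) * ∫⁻ y in closedAnnulus E ρ, w y ∂μ :=
        setLIntegral_closedAnnulus_rpow_mul_le hρ a
    _ ≤ ENNReal.ofReal (2 ^ |a| * ρ ^ a) * ∫⁻ y in ball 0 (3 * ρ), w y ∂μ := by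
        gcongr
        intro y hy
        rw [mem_ball_zero_iff]
        linarith [hy.2]
    _ ≤ ENNReal.ofReal (2 ^ |a| * ρ ^ a) * (ENNReal.ofReal ((3 * ρ) ^ e) * (C * M)) := by
        gcongr
        exact hC w M hw h 0 _ (by positivity)
    _ = _ := by
        have : ((2 ^ |a| * 3 ^ e * C : ℝ≥0) : ℝ≥0∞) = ENNReal.ofReal (2 ^ |a| * 3 ^ e) * C := by
          rw [ENNReal.coe_mul, ENNReal.ofReal, Real.toNNReal_of_nonneg (by positivity)]
          rfl
        rw [this, ← mul_assoc, ← mul_assoc, ← mul_assoc, ← mul_assoc,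
          ← ENNReal.ofReal_mul (by positivity), ← ENNReal.ofReal_mul (by positivity),
          Real.mul_rpow (by norm_num) hρ.le, Real.rpow_add hρ]
        ring_nf

theorem MorreyBound.setLIntegral_ball_rpow_le (hp : 1 < p) {a : ℝ}
    (ha : 0 < a + ((Module.finrank ℝ E : ℝ) - (Module.finrank ℝ E - lam) / p)) :
    ∃ C : ℝ≥0, ∀ (w : E → ℝ≥0∞) (M : ℝ≥0∞), Measurable w → MorreyBound μ p lam w M →
      ∀ R : ℝ, 0 < R → ∫⁻ y in ball 0 R, ENNReal.ofReal (‖y‖ ^ a) * w y ∂μ ≤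
        ENNReal.ofReal (R ^ (a + ((Module.finrank ℝ E : ℝ) - (Module.finrank ℝ E - lam) / p))) *
          (C * M) := by
  obtain ⟨C, hC⟩ := MorreyBound.setLIntegral_closedAnnulus_le (E := E) (μ := μ) (lam := lam) hp a
  set e := a + ((Module.finrank ℝ E : ℝ) - (Module.finrank ℝ E - lam) / p)
  refine ⟨(1 - (2 : ℝ) ^ (-e))⁻¹.toNNReal * C, fun w M hw h R hR => ?_⟩
  refine (setLIntegral_ball_le_of_closedAnnulus ha (hC w M hw h) hR).trans_eq ?_
  have hq : (2 : ℝ) ^ (-e) < 1 :=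
    Real.rpow_lt_one_of_one_lt_of_neg (by norm_num) (by linarith)
  rw [ENNReal.ofReal_mul (inv_nonneg.2 (by linarith)), ENNReal.coe_mul]
  change _ = _ * (ENNReal.ofReal _ * C * M)
  ring

theorem MorreyBound.setLIntegral_compl_ball_rpow_le (hp : 1 < p) {a : ℝ}
    (ha : a + ((Module.finrank ℝ E : ℝ) - (Module.finrank ℝ E - lam) / p) < 0) :
    ∃ C : ℝ≥0, ∀ (w : E → ℝ≥0∞) (M : ℝ≥0∞), Measurable w → MorreyBound μ p lam w M →
      ∀ R : ℝ, 0 < R → ∫⁻ y in (ball 0 R)ᶜ, ENNReal.ofReal (‖y‖ ^ a) * w y ∂μ ≤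
        ENNReal.ofReal (R ^ (a + ((Module.finrank ℝ E : ℝ) - (Module.finrank ℝ E - lam) / p))) *
          (C * M) := by
  obtain ⟨C, hC⟩ := MorreyBound.setLIntegral_closedAnnulus_le (E := E) (μ := μ) (lam := lam) hp a
  set e := a + ((Module.finrank ℝ E : ℝ) - (Module.finrank ℝ E - lam) / p)
  refine ⟨(1 - (2 : ℝ) ^ e)⁻¹.toNNReal * C, fun w M hw h R hR => ?_⟩
  refine (setLIntegral_compl_ball_le_of_closedAnnulus ha (hC w M hw h) hR).trans_eq ?_
  have hq : (2 : ℝ) ^ e < 1 :=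
    Real.rpow_lt_one_of_one_lt_of_neg (by norm_num) (by linarith)
  rw [ENNReal.ofReal_mul (inv_nonneg.2 (by linarith)), ENNReal.coe_mul]
  change _ = _ * (ENNReal.ofReal _ * C * M)
  ring

/-- The critical power weight belongs to the Morrey space. -/
theorem morreyBound_rpow_norm (hp : 0 < p) (hlam : 0 < lam) (hlam' : lam ≤ Module.finrank ℝ E) :
    ∃ C : ℝ≥0, MorreyBound μ p lam
      (fun x => ENNReal.ofReal (‖x‖ ^ (-((Module.finrank ℝ E - lam) / p)))) C := by
  obtain ⟨C, hC⟩ := MorreyBound.of_annuli (E := E) (μ := μ) hp hlam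
  set d : ℝ := ((Module.finrank ℝ E : ℕ) : ℝ)
  set A : ℝ≥0 := (ENNReal.ofReal (5 ^ (d - lam)) * μ (ball (0 : E) 1)).toNNReal ^ (1 / p) with hA
  refine ⟨C * A, ?_⟩
  rw [ENNReal.coe_mul]
  refine hC _ A fun a r c ha hr => ?_
  have hAp : (A : ℝ≥0∞) ^ p = ENNReal.ofReal (5 ^ (d - lam)) * μ (ball (0 : E) 1) := by
    rw [hA, ← ENNReal.coe_rpow_of_nonneg _ hp.le, ← NNReal.rpow_mul, one_div_mul_cancel hp.ne',
      NNReal.rpow_one, ENNReal.coe_toNNReal]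
    exact ENNReal.mul_ne_top ENNReal.ofReal_ne_top measure_ball_lt_top.ne
  -- The piece has measure at most a multiple of both `r ^ d` and `(5 * a) ^ d`. Splitting `min ^ d
  -- = min ^ lam * min ^ (d - lam)` and using one bound in each factor leaves `r ^ lam`, with the
  -- powers of `a` cancelling.
  have hmin : 0 < min r (5 * a) := by positivity
  calc _ ≤ ∫⁻ y in ball c r ∩ {x | a ≤ ‖x‖ ∧ ‖x‖ ≤ 4 * a}, ENNReal.ofReal (a ^ (lam - d)) ∂μ := by
        refine setLIntegral_mono measurable_const fun y hy => ?_
        rw [ENNReal.ofReal_rpow_of_nonneg (by positivity) hp.le, ← Real.rpow_mul (norm_nonneg _),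
          neg_mul, div_mul_cancel₀ _ hp.ne', neg_sub]
        exact ENNReal.ofReal_le_ofReal (Real.rpow_le_rpow_of_nonpos ha hy.2.1 (by linarith))
    _ = ENNReal.ofReal (a ^ (lam - d)) * μ (ball c r ∩ {x | a ≤ ‖x‖ ∧ ‖x‖ ≤ 4 * a}) := by
        simp
    _ ≤ ENNReal.ofReal (a ^ (lam - d)) * (ENNReal.ofReal (min r (5 * a) ^ d) * μ (ball 0 1)) := by
        gcongr
        rcases min_choice r (5 * a) with h | h <;> rw [h]
        · exact (measure_mono Set.inter_subset_left).trans_eq (addHaar_ball_rpow c hr)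
        · rw [← addHaar_ball_rpow (0 : E) (by positivity)]
          refine measure_mono fun y hy => ?_
          rw [mem_ball_zero_iff]
          linarith [hy.2.2]
    _ ≤ _ := by
        rw [hAp, ← mul_assoc, ← mul_assoc, ← ENNReal.ofReal_mul (by positivity),
          ← ENNReal.ofReal_mul (by positivity)]
        refine mul_le_mul' (ENNReal.ofReal_le_ofReal ?_) le_rfl
        calc a ^ (lam - d) * min r (5 * a) ^ d
            = a ^ (lam - d) * (min r (5 * a) ^ lam * min r (5 * a) ^ (d - lam)) := by
              rw [← Real.rpow_add hmin]; ring_nf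
          _ ≤ a ^ (lam - d) * (r ^ lam * (5 * a) ^ (d - lam)) := by
              gcongr
              · exact min_le_left _ _
              · exact min_le_right _ _
          _ = r ^ lam * 5 ^ (d - lam) * (a ^ (lam - d) * a ^ (d - lam)) := by
              rw [Real.mul_rpow (by norm_num) ha.le]; ring
          _ = _ := by
              rw [← Real.rpow_add ha]; simp

end MorreyPower

/-! ### Boundedness of the weighted Riesz potential. -/

section RieszPotential

/-- Jensen's inequality without normalizing the measure: Hölder against the constant 1. -/
theorem lintegral_rpow_le_measure_univ_rpow_mul {α : Type*} [MeasurableSpace α] (ν : Measure α)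
    {p : ℝ} (hp : 1 < p) {w : α → ℝ≥0∞} (hw : AEMeasurable w ν) :
    (∫⁻ y, w y ∂ν) ^ p ≤ ν Set.univ ^ (p - 1) * ∫⁻ y, w y ^ p ∂ν := by
  have hpq : p.HolderConjugate p.conjExponent := Real.HolderConjugate.conjExponent hp
  have hp0 : 0 < p := by linarith
  set q := p.conjExponent
  calc (∫⁻ y, w y ∂ν) ^ p = (∫⁻ y, (w * fun _ : α => (1 : ℝ≥0∞)) y ∂ν) ^ p := by simp
    _ ≤ ((∫⁻ y, w y ^ p ∂ν) ^ (1 / p) * (∫⁻ y, 1 ^ q ∂ν) ^ (1 / q)) ^ p := by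
        gcongr
        exact ENNReal.lintegral_mul_le_Lp_mul_Lq _ hpq hw aemeasurable_const
    _ = _ := by
        have e : 1 / q * p = p - 1 := by
          have := hpq.inv_add_inv_eq_one
          rw [one_div, eq_sub_of_add_eq' this, sub_mul, one_mul, inv_mul_cancel₀ hp0.ne']
        rw [ENNReal.mul_rpow_of_nonneg _ _ hp0.le, ← ENNReal.rpow_mul, one_div_mul_cancel hp0.ne',
          ENNReal.rpow_one, ← ENNReal.rpow_mul, e, mul_comm]
        simp

variable {E : Type*} [NormedAddCommGroup E] [NormedSpace ℝ E] [FiniteDimensional ℝ E]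
  [MeasurableSpace E] [BorelSpace E] {μ : Measure E} [μ.IsAddHaarMeasure]
  {p lam : ℝ}

/-- The constant 1 has a Morrey bound with `lam = d`, for which the term `(d - lam) / p` disappears,
so this is a case of the weighted estimate; `p = 2` is an arbitrary choice. -/
theorem setLIntegral_ball_rpow_norm_le [Nontrivial E] {a : ℝ} (ha : 0 < a + Module.finrank ℝ E) :
    ∃ C : ℝ≥0, ∀ R : ℝ, 0 < R → ∫⁻ y in ball (0 : E) R, ENNReal.ofReal (‖y‖ ^ a) ∂μ ≤
      ENNReal.ofReal (R ^ (a + Module.finrank ℝ E)) * C := by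
  have h1 : MorreyBound μ 2 (Module.finrank ℝ E : ℝ) (fun _ => 1)
      (((μ (ball (0 : E) 1)).toNNReal ^ (1 / 2 : ℝ) : ℝ≥0) : ℝ≥0∞) := fun x r hr => by
    rw [← ENNReal.coe_rpow_of_nonneg _ (by norm_num), ← NNReal.rpow_mul]
    norm_num
    rw [addHaar_ball_rpow x hr, Real.rpow_natCast,
      ENNReal.coe_toNNReal measure_ball_lt_top.ne]
  obtain ⟨C, hC⟩ := MorreyBound.setLIntegral_ball_rpow_le (E := E) (μ := μ) (p := 2)
    (lam := Module.finrank ℝ E) (a := a) (by norm_num) (by simpa using ha)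
  refine ⟨C * (μ (ball (0 : E) 1)).toNNReal ^ (1 / 2 : ℝ), fun R hR => ?_⟩
  simpa using hC _ _ measurable_const h1 R hR

/-- The part of the Riesz potential of `w` at `x` coming from the points near `x`, on the
scale of `‖x‖`. -/
noncomputable def localRieszPotential (μ : Measure E) (γ : ℝ) (w : E → ℝ≥0∞) (x : E) : ℝ≥0∞ :=
  ENNReal.ofReal (‖x‖ ^ (-γ)) *
    ∫⁻ z in ball 0 (3 * ‖x‖), ENNReal.ofReal (‖z‖ ^ (γ - Module.finrank ℝ E)) * w (x - z) ∂μ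

/-- For `a ≤ ‖x‖ ≤ 4 * a` the prefactor is at most `a ^ (-γ)` and the domain lies in `ball 0 (12 *
a)`. The operator is thus dominated by convolution with the measure `ν` below, whose mass is bounded
independently of `a`. Jensen and Tonelli reduce to integrals of `w ^ p` over the balls `ball (c - z)
r`, which share one bound. -/
theorem MorreyBound.localRieszPotential [Nontrivial E] (hp : 1 < p) (hlam : 0 < lam) {γ : ℝ} (hγ : 0 < γ) :
    ∃ C : ℝ≥0, ∀ (w : E → ℝ≥0∞) (M : ℝ≥0∞), Measurable w → MorreyBound μ p lam w M →
      MorreyBound μ p lam (localRieszPotential μ γ w) (C * M) := by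
  have hp0 : 0 < p := by linarith
  obtain ⟨C₁, hC₁⟩ := MorreyBound.of_annuli (E := E) (μ := μ) hp0 hlam
  obtain ⟨C₂, hC₂⟩ := setLIntegral_ball_rpow_norm_le (E := E) (μ := μ)
    (a := γ - Module.finrank ℝ E) (by simpa using hγ)
  rw [sub_add_cancel] at hC₂
  set K : ℝ≥0 := (12 : ℝ≥0) ^ γ * C₂ with hK
  refine ⟨C₁ * K, fun w M hw h => ?_⟩
  rw [ENNReal.coe_mul, mul_assoc]
  refine hC₁ _ _ fun a r c ha hr => ?_
  set k : E → ℝ≥0∞ := fun z => ENNReal.ofReal (‖z‖ ^ (γ - Module.finrank ℝ E)) with hk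
  have hkm : Measurable k := by fun_prop
  set ν : Measure E := ENNReal.ofReal (a ^ (-γ)) • (μ.restrict (ball 0 (12 * a))).withDensity k
    with hν
  have hνi : ∀ f : E → ℝ≥0∞, Measurable f → ∫⁻ z, f z ∂ν =
      ENNReal.ofReal (a ^ (-γ)) * ∫⁻ z in ball 0 (12 * a), k z * f z ∂μ := fun f hf => by
    rw [hν, lintegral_smul_measure, lintegral_withDensity_eq_lintegral_mul _ hkm hf]
    rfl
  have hν1 : ν Set.univ ≤ K := by
    rw [← lintegral_one, hνi _ measurable_const]
    simp only [mul_one]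
    refine (mul_le_mul' le_rfl (hC₂ _ (by positivity))).trans_eq ?_
    rw [← mul_assoc, ← ENNReal.ofReal_mul (by positivity), Real.mul_rpow (by norm_num) ha.le,
      mul_left_comm, ← Real.rpow_add ha, hK, ENNReal.coe_mul, ENNReal.ofReal]
    simp only [neg_add_cancel, Real.rpow_zero, mul_one]
    rw [Real.toNNReal_of_nonneg (by positivity)]
    rfl
  have : IsFiniteMeasure ν := ⟨hν1.trans_lt ENNReal.coe_lt_top⟩
  have hwm : Measurable fun q : E × E => w (q.1 - q.2) := hw.comp (measurable_fst.sub measurable_snd)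
  calc ∫⁻ x in ball c r ∩ {x | a ≤ ‖x‖ ∧ ‖x‖ ≤ 4 * a}, _root_.localRieszPotential μ γ w x ^ p ∂μ
      ≤ ∫⁻ x in ball c r ∩ {x | a ≤ ‖x‖ ∧ ‖x‖ ≤ 4 * a}, (∫⁻ z, w (x - z) ∂ν) ^ p ∂μ := by
        refine setLIntegral_mono' (measurableSet_ball.inter
          ((isClosed_le continuous_const continuous_norm).measurableSet.inter
          (isClosed_le continuous_norm continuous_const).measurableSet)) fun x hx => ?_
        gcongr
        rw [hνi _ (by fun_prop)]
        unfold _root_.localRieszPotential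
        gcongr ?_ * ?_
        · exact ENNReal.ofReal_le_ofReal (Real.rpow_le_rpow_of_nonpos ha hx.2.1 (by linarith))
        · exact lintegral_mono_set (ball_subset_ball (by linarith [hx.2.2]))
    _ ≤ ∫⁻ x in ball c r, (K : ℝ≥0∞) ^ (p - 1) * ∫⁻ z, w (x - z) ^ p ∂ν ∂μ := by
        refine (lintegral_mono_set Set.inter_subset_left).trans (lintegral_mono fun x => ?_)
        refine (lintegral_rpow_le_measure_univ_rpow_mul ν hp (by fun_prop)).trans ?_
        gcongr
    _ = (K : ℝ≥0∞) ^ (p - 1) * ∫⁻ z, ∫⁻ x in ball c r, w (x - z) ^ p ∂μ ∂ν := by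
        rw [lintegral_const_mul' _ _ (ENNReal.rpow_ne_top_of_nonneg (by linarith) (by simp)),
          lintegral_lintegral_swap]
        exact (hwm.pow_const p).aemeasurable
    _ ≤ (K : ℝ≥0∞) ^ (p - 1) * ∫⁻ _, ENNReal.ofReal (r ^ lam) * M ^ p ∂ν := by
        gcongr with z
        refine le_trans (le_of_eq ?_) (h (c - z) r hr)
        rw [← lintegral_indicator measurableSet_ball, ← lintegral_indicator measurableSet_ball]
        refine Eq.trans ?_ (lintegral_sub_right_eq_self _ z)
        congr 1 with x
        simp only [Set.indicator, mem_ball, dist_sub_right]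
    _ ≤ (K : ℝ≥0∞) ^ (p - 1) * (ENNReal.ofReal (r ^ lam) * M ^ p * K) := by
        rw [lintegral_const]
        gcongr
    _ = _ := by
        rw [ENNReal.mul_rpow_of_nonneg _ _ hp0.le]
        rcases eq_or_ne K 0 with h0 | h0
        · rw [h0]; simp [hp0]
        · rw [show (K : ℝ≥0∞) ^ p = K ^ (p - 1) * K by
            conv_rhs => rw [← ENNReal.rpow_one (K : ℝ≥0∞), ← ENNReal.rpow_mul, one_mul]
            rw [← ENNReal.rpow_add _ _ (by simpa using h0) (by simp)]; simp]
          ring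

/-- The operator with kernel `‖x‖ ^ (-β) * ‖x - y‖ ^ (γ - d) * ‖y‖ ^ (-α)`. -/
noncomputable def weightedRieszPotential (μ : Measure E) (α β γ : ℝ) (w : E → ℝ≥0∞) (x : E) : ℝ≥0∞ :=
  ENNReal.ofReal (‖x‖ ^ (-β)) *
    ∫⁻ y, ENNReal.ofReal (‖x - y‖ ^ (γ - Module.finrank ℝ E)) *
      (ENNReal.ofReal (‖y‖ ^ (-α)) * w y) ∂μ

/-- For `‖y‖ < ‖x‖ / 2` one has `‖x - y‖ ≥ ‖x‖ / 2`, and for `‖y‖ ≥ 2 * ‖x‖` one has `‖x - y‖ ≥ ‖y‖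
/ 2`; these give the two Hardy terms. In between, `‖y‖ ^ (-α)` is comparable to `‖x‖ ^ (-α)` and the
local potential remains. -/
theorem weightedRieszPotential_le {α β γ : ℝ} (hγ : α + β = γ) (hγd : γ ≤ Module.finrank ℝ E)
    (w : E → ℝ≥0∞) {x : E} (hx : x ≠ 0) :
    weightedRieszPotential μ α β γ w x ≤
      ENNReal.ofReal (2 ^ ((Module.finrank ℝ E : ℝ) - γ)) * (ENNReal.ofReal (‖x‖ ^ (α - Module.finrank ℝ E)) *
        ∫⁻ y in ball 0 ‖x‖, ENNReal.ofReal (‖y‖ ^ (-α)) * w y ∂μ +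
      ENNReal.ofReal (‖x‖ ^ (-β)) *
        ∫⁻ y in (ball 0 ‖x‖)ᶜ, ENNReal.ofReal (‖y‖ ^ (β - Module.finrank ℝ E)) * w y ∂μ) +
      ENNReal.ofReal (2 ^ |α|) * localRieszPotential μ γ w x := by
  set d : ℝ := ((Module.finrank ℝ E : ℕ) : ℝ) with hd
  have hx0 : 0 < ‖x‖ := norm_pos_iff.2 hx
  set F : E → ℝ≥0∞ := fun y => ENNReal.ofReal (‖x - y‖ ^ (γ - d)) *
      (ENNReal.ofReal (‖y‖ ^ (-α)) * w y) with hF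
  have hsplit : ∫⁻ y, F y ∂μ ≤ ∫⁻ y in ball 0 (‖x‖ / 2), F y ∂μ +
      ∫⁻ y in (ball 0 (2 * ‖x‖))ᶜ, F y ∂μ + ∫⁻ y in ball x (3 * ‖x‖) ∩ closedAnnulus E (‖x‖ / 2) ∪
        (ball x (3 * ‖x‖) ∩ closedAnnulus E ‖x‖), F y ∂μ := by
    rw [← setLIntegral_univ]
    refine (lintegral_mono_set fun y _ => ?_).trans ((lintegral_union_le _ _ _).trans
      (add_le_add_left (lintegral_union_le _ _ _) _))
    by_cases h1 : ‖y‖ < ‖x‖ / 2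
    · exact Or.inl (Or.inl (by simpa using h1))
    by_cases h2 : 2 * ‖x‖ ≤ ‖y‖
    · exact Or.inl (Or.inr (by simpa using h2))
    push Not at h1 h2
    have h3 : y ∈ ball x (3 * ‖x‖) := by
      rw [mem_ball_iff_norm]
      linarith [norm_sub_le y x]
    rcases le_total ‖y‖ ‖x‖ with h4 | h4
    · exact Or.inr (Or.inl ⟨h3, h1, by linarith⟩)
    · exact Or.inr (Or.inr ⟨h3, h4, h2.le⟩)
  have hin : ∫⁻ y in ball 0 (‖x‖ / 2), F y ∂μ ≤ ENNReal.ofReal (2 ^ (d - γ) * ‖x‖ ^ (γ - d)) *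
      ∫⁻ y in ball 0 ‖x‖, ENNReal.ofReal (‖y‖ ^ (-α)) * w y ∂μ := by
    rw [← lintegral_const_mul' _ _ ENNReal.ofReal_ne_top]
    refine (setLIntegral_mono' measurableSet_ball fun y hy => ?_).trans
      (lintegral_mono_set (ball_subset_ball (by linarith)))
    rw [mem_ball_zero_iff] at hy
    simp only [hF]
    gcongr
    have h1 := norm_sub_norm_le x y
    calc ‖x - y‖ ^ (γ - d) ≤ (‖x‖ / 2) ^ (γ - d) :=
          Real.rpow_le_rpow_of_nonpos (by positivity) (by linarith) (by linarith)
      _ = _ := by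
        rw [div_eq_inv_mul, Real.mul_rpow (by norm_num) hx0.le, Real.inv_rpow (by norm_num),
          ← Real.rpow_neg (by norm_num), neg_sub]
  have hout : ∫⁻ y in (ball 0 (2 * ‖x‖))ᶜ, F y ∂μ ≤ ENNReal.ofReal (2 ^ (d - γ)) *
      ∫⁻ y in (ball 0 ‖x‖)ᶜ, ENNReal.ofReal (‖y‖ ^ (β - d)) * w y ∂μ := by
    rw [← lintegral_const_mul' _ _ ENNReal.ofReal_ne_top]
    refine (setLIntegral_mono' measurableSet_ball.compl fun y hy => ?_).trans
      (lintegral_mono_set (Set.compl_subset_compl.2 (ball_subset_ball (by linarith))))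
    rw [Set.mem_compl_iff, mem_ball_zero_iff, not_lt] at hy
    have hy0 : 0 < ‖y‖ := by linarith
    simp only [hF]
    rw [← mul_assoc, ← mul_assoc, ← ENNReal.ofReal_mul (by positivity),
      ← ENNReal.ofReal_mul (by positivity)]
    refine mul_le_mul' (ENNReal.ofReal_le_ofReal ?_) le_rfl
    have h1 := norm_sub_norm_le y x
    rw [norm_sub_rev] at h1
    calc ‖x - y‖ ^ (γ - d) * ‖y‖ ^ (-α) ≤ (‖y‖ / 2) ^ (γ - d) * ‖y‖ ^ (-α) := by
          gcongr ?_ * _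
          exact Real.rpow_le_rpow_of_nonpos (by positivity) (by linarith) (by linarith)
      _ = _ := by
        rw [div_eq_inv_mul, Real.mul_rpow (by norm_num) hy0.le, Real.inv_rpow (by norm_num),
          ← Real.rpow_neg (by norm_num), neg_sub, mul_assoc, ← Real.rpow_add hy0, ← hγ]
        ring_nf
  have hmid : ∫⁻ y in ball x (3 * ‖x‖) ∩ closedAnnulus E (‖x‖ / 2) ∪
        (ball x (3 * ‖x‖) ∩ closedAnnulus E ‖x‖), F y ∂μ ≤ ENNReal.ofReal (2 ^ |α| * ‖x‖ ^ (-α)) *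
      ∫⁻ z in ball 0 (3 * ‖x‖), ENNReal.ofReal (‖z‖ ^ (γ - d)) * w (x - z) ∂μ := by
    have hshift : ∫⁻ z in ball 0 (3 * ‖x‖), ENNReal.ofReal (‖z‖ ^ (γ - d)) * w (x - z) ∂μ =
        ∫⁻ y in ball x (3 * ‖x‖), ENNReal.ofReal (‖x - y‖ ^ (γ - d)) * w y ∂μ := by
      rw [← lintegral_indicator measurableSet_ball, ← lintegral_indicator measurableSet_ball,
        ← lintegral_sub_left_eq_self _ x]
      congr 1 with y
      simp only [Set.indicator, mem_ball_iff_norm', zero_sub, norm_neg, sub_sub_cancel]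
    rw [hshift, ← lintegral_const_mul' _ _ ENNReal.ofReal_ne_top, ← Set.inter_union_distrib_left]
    refine (setLIntegral_mono' (measurableSet_ball.inter
      ((measurableSet_closedAnnulus _).union (measurableSet_closedAnnulus _))) fun y hy => ?_).trans
      (lintegral_mono_set Set.inter_subset_left)
    simp only [hF]
    rw [mul_left_comm]
    gcongr
    rw [← abs_neg α]
    refine rpow_le_of_mem_Icc hx0 (by norm_num) ?_ ?_ _
    · rcases hy.2 with h | h
      · exact h.1
      · linarith [h.1]
    · rcases hy.2 with h | h
      · linarith [h.2]
      · exact h.2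
  have hγβ : ‖x‖ ^ (-γ) = ‖x‖ ^ (-β) * ‖x‖ ^ (-α) := by
    rw [← Real.rpow_add hx0, ← hγ]; ring_nf
  have hαd : ‖x‖ ^ (α - d) = ‖x‖ ^ (-β) * ‖x‖ ^ (γ - d) := by
    rw [← Real.rpow_add hx0, ← hγ]; ring_nf
  unfold weightedRieszPotential localRieszPotential
  refine (mul_le_mul' le_rfl (hsplit.trans (add_le_add (add_le_add hin hout) hmid))).trans_eq ?_
  rw [← hd, hγβ, hαd, ENNReal.ofReal_mul (by positivity), ENNReal.ofReal_mul (by positivity),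
    ENNReal.ofReal_mul (by positivity), ENNReal.ofReal_mul (by positivity)]
  ring

/-- The bounds on `α` and `β` are the convergence conditions of the two Hardy terms at the origin
and at infinity. Both terms evaluate to the critical power `‖x‖ ^ (-(d - lam) / p)` times `M`. -/
theorem MorreyBound.weightedRieszPotential_of_measurable [Nontrivial E] {α β γ : ℝ} (hp : 1 < p) (hlam : 0 < lam)
    (hlam' : lam ≤ Module.finrank ℝ E)
    (hα : α < Module.finrank ℝ E - (Module.finrank ℝ E - lam) / p)
    (hβ : β < (Module.finrank ℝ E - lam) / p) (hγ : α + β = γ) (hγ0 : 0 < γ) :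
    ∃ C : ℝ≥0, ∀ (w : E → ℝ≥0∞) (M : ℝ≥0∞), Measurable w → M ≠ ⊤ →
      MorreyBound μ p lam w M →
      MorreyBound μ p lam (weightedRieszPotential μ α β γ w) (C * M) := by
  have hp0 : 0 < p := by linarith
  obtain ⟨C₁, hC₁⟩ := MorreyBound.setLIntegral_ball_rpow_le (E := E) (μ := μ) (lam := lam) hp
    (a := -α) (by linarith)
  obtain ⟨C₂, hC₂⟩ := MorreyBound.setLIntegral_compl_ball_rpow_le (E := E) (μ := μ) (lam := lam) hp
    (a := β - Module.finrank ℝ E) (by linarith)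
  obtain ⟨C₃, hC₃⟩ := MorreyBound.localRieszPotential (E := E) (μ := μ) hp hlam hγ0
  obtain ⟨C₄, hC₄⟩ := morreyBound_rpow_norm (E := E) (μ := μ) hp0 hlam hlam'
  set d : ℝ := ((Module.finrank ℝ E : ℕ) : ℝ) with hd
  set δ : ℝ := (d - lam) / p with hδ
  set K₁ : ℝ≥0 := 2 ^ (d - γ) with hK₁
  set K₂ : ℝ≥0 := 2 ^ |α| with hK₂
  have eK₁ : ENNReal.ofReal (2 ^ (d - γ)) = K₁ := by
    rw [ENNReal.ofReal, Real.toNNReal_of_nonneg (by positivity)]; rfl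
  have eK₂ : ENNReal.ofReal (2 ^ |α|) = K₂ := by
    rw [ENNReal.ofReal, Real.toNNReal_of_nonneg (by positivity)]; rfl
  refine ⟨2 * (K₁ * (C₁ + C₂) * C₄ + K₂ * C₃), fun w M hw hM h => ?_⟩
  have hA := hC₄.const_mul hp0.le (c := K₁ * (C₁ + C₂) * M) (by finiteness)
  have hB := (hC₃ w M hw h).const_mul hp0.le (c := K₂) (by simp)
  have hAB := hA.add hp.le (by fun_prop) hB
  refine MorreyBound.mono (M := _) hp0.le (by convert hAB using 1; push_cast; ring) ?_
  filter_upwards [(measure_singleton (μ := μ) (0 : E) : μ {0} = 0) |> compl_mem_ae_iff.2] with x hx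
  have hx : x ≠ 0 := hx
  have hx0 : 0 < ‖x‖ := norm_pos_iff.2 hx
  refine (weightedRieszPotential_le hγ (by linarith) w hx).trans ?_
  rw [eK₁, eK₂]
  refine add_le_add ?_ le_rfl
  calc _ ≤ (K₁ : ℝ≥0∞) * (ENNReal.ofReal (‖x‖ ^ (α - d)) *
        (ENNReal.ofReal (‖x‖ ^ (-α + (d - δ))) * (C₁ * M)) +
        ENNReal.ofReal (‖x‖ ^ (-β)) *
          (ENNReal.ofReal (‖x‖ ^ (β - d + (d - δ))) * (C₂ * M))) := by
        gcongr
        · exact hC₁ w M hw h _ hx0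
        · exact hC₂ w M hw h _ hx0
    _ = _ := by
        rw [← mul_assoc (ENNReal.ofReal _), ← mul_assoc (ENNReal.ofReal _),
          ← ENNReal.ofReal_mul (by positivity), ← ENNReal.ofReal_mul (by positivity),
          ← Real.rpow_add hx0, ← Real.rpow_add hx0,
          show α - d + (-α + (d - δ)) = -δ by ring, show -β + (β - d + (d - δ)) = -δ by ring]
        ring

/-- The weighted Riesz potential with kernel homogeneous of degree `-d` is bounded on Morrey
spaces. -/
theorem MorreyBound.weightedRieszPotential [Nontrivial E] {α β γ : ℝ} (hp : 1 < p) (hlam : 0 < lam)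
    (hlam' : lam ≤ Module.finrank ℝ E)
    (hα : α < Module.finrank ℝ E - (Module.finrank ℝ E - lam) / p)
    (hβ : β < (Module.finrank ℝ E - lam) / p) (hγ : α + β = γ) (hγ0 : 0 < γ) :
    ∃ C : ℝ≥0, ∀ (w : E → ℝ≥0∞) (M : ℝ≥0∞), AEMeasurable w μ → M ≠ ⊤ →
      MorreyBound μ p lam w M →
      MorreyBound μ p lam (weightedRieszPotential μ α β γ w) (C * M) := by
  obtain ⟨C, hC⟩ := MorreyBound.weightedRieszPotential_of_measurable (E := E) (μ := μ) hp hlam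
    hlam' hα hβ hγ hγ0
  refine ⟨C, fun w M hw hM h => ?_⟩
  have hp0 : 0 ≤ p := by linarith
  refine (hC (hw.mk w) M hw.measurable_mk hM
    (h.mono hp0 (hw.ae_eq_mk.mono fun x hx => hx.ge))).mono hp0 (.of_forall fun x => le_of_eq ?_)
  unfold _root_.weightedRieszPotential
  congr 1
  exact lintegral_congr_ae (hw.ae_eq_mk.mono fun y hy => by simp only [hy])

end RieszPotential

/-! ### The truncated field `z / ‖z‖ ^ d` and its divergence, in the variable `q = ‖z‖ ^ 2`. -/

section RadialCutoff

/-- A smooth function on `ℝ`, equal to `1` on `(-∞, 1]` and to `0` on `[2, ∞)`. -/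
noncomputable def smoothCutoff (q : ℝ) : ℝ := Real.smoothTransition (2 - q)

theorem contDiff_smoothCutoff : ContDiff ℝ ∞ smoothCutoff :=
  Real.smoothTransition.contDiff.comp (contDiff_const.sub contDiff_id)

theorem smoothCutoff_of_le_one {q : ℝ} (hq : q ≤ 1) : smoothCutoff q = 1 :=
  Real.smoothTransition.one_of_one_le (by linarith)

theorem smoothCutoff_of_two_le {q : ℝ} (hq : 2 ≤ q) : smoothCutoff q = 0 :=
  Real.smoothTransition.zero_of_nonpos (by linarith)

theorem smoothCutoff_nonneg (q : ℝ) : 0 ≤ smoothCutoff q := Real.smoothTransition.nonneg _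

theorem smoothCutoff_le_one (q : ℝ) : smoothCutoff q ≤ 1 := Real.smoothTransition.le_one _

theorem antitone_smoothCutoff : Antitone smoothCutoff := fun a b h =>
  Real.smoothTransition.monotone (by linarith)

theorem contDiff_deriv_smoothCutoff : ContDiff ℝ ∞ (deriv smoothCutoff) :=
  (contDiff_infty_iff_deriv.1 contDiff_smoothCutoff).2

theorem deriv_smoothCutoff_of_lt_one {q : ℝ} (hq : q < 1) : deriv smoothCutoff q = 0 := by
  have : smoothCutoff =ᶠ[𝓝 q] fun _ => 1 := by
    filter_upwards [Iio_mem_nhds hq] with y hy using smoothCutoff_of_le_one (le_of_lt hy)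
  rw [this.deriv_eq, deriv_const]

theorem deriv_smoothCutoff_of_two_lt {q : ℝ} (hq : 2 < q) : deriv smoothCutoff q = 0 := by
  have : smoothCutoff =ᶠ[𝓝 q] fun _ => 0 := by
    filter_upwards [Ioi_mem_nhds hq] with y hy using smoothCutoff_of_two_le (le_of_lt hy)
  rw [this.deriv_eq, deriv_const]

theorem exists_abs_deriv_smoothCutoff_le : ∃ H : ℝ, ∀ q, |deriv smoothCutoff q| ≤ H := by
  have hc : HasCompactSupport (deriv smoothCutoff) := by
    refine HasCompactSupport.intro (isCompact_Icc (a := (1 : ℝ)) (b := 2)) fun q hq => ?_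
    rw [Set.mem_Icc, not_and_or, not_le, not_le] at hq
    exact hq.elim deriv_smoothCutoff_of_lt_one deriv_smoothCutoff_of_two_lt
  obtain ⟨H, hH⟩ := hc.exists_bound_of_continuous contDiff_deriv_smoothCutoff.continuous
  exact ⟨H, fun q => by simpa using hH q⟩

theorem contDiff_rpow_mul {f : ℝ → ℝ} (hf : ContDiff ℝ ∞ f) {a : ℝ} (ha : 0 < a)
    (hf0 : ∀ q < a, f q = 0) (s : ℝ) : ContDiff ℝ ∞ fun q => q ^ s * f q := by
  refine contDiff_iff_contDiffAt.2 fun q => ?_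
  rcases lt_or_ge q a with h | h
  · refine (contDiffAt_const (c := (0 : ℝ))).congr_of_eventuallyEq ?_
    filter_upwards [Iio_mem_nhds h] with y hy
    rw [hf0 y hy, mul_zero]
  · exact (Real.contDiffAt_rpow_const_of_ne (by linarith)).mul hf.contDiffAt

/-- The profile of the radial field whose divergence is a difference of two averaging kernels. -/
noncomputable def radialProfile (d ε R : ℝ) (q : ℝ) : ℝ :=
  q ^ (-(d / 2)) * (smoothCutoff (q / R ^ 2) - smoothCutoff (q / ε ^ 2))

/-- The profile of a radial averaging kernel at scale `t`. -/
noncomputable def averagingProfile (d t : ℝ) (q : ℝ) : ℝ :=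
  q ^ (1 - d / 2) * (-2 * deriv smoothCutoff (q / t ^ 2) / t ^ 2)

variable {d ε R t : ℝ}

theorem contDiff_radialProfile (hε : 0 < ε) (hR : ε ≤ R) : ContDiff ℝ ∞ (radialProfile d ε R) := by
  refine contDiff_rpow_mul ((contDiff_smoothCutoff.comp (contDiff_id.div_const _)).sub
    (contDiff_smoothCutoff.comp (contDiff_id.div_const _))) (a := ε ^ 2) (by positivity)
    (fun q hq => ?_) _
  have hR0 : 0 < R := by linarith
  simp only [id, Function.comp]
  rw [smoothCutoff_of_le_one, smoothCutoff_of_le_one, sub_self]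
  · rw [div_le_one (by positivity)]; exact hq.le
  · rw [div_le_one (by positivity)]; exact hq.le.trans (by gcongr)

theorem contDiff_averagingProfile (ht : 0 < t) : ContDiff ℝ ∞ (averagingProfile d t) := by
  refine contDiff_rpow_mul ((contDiff_const.mul (contDiff_deriv_smoothCutoff.comp
    (contDiff_id.div_const _))).div_const _) (a := t ^ 2) (by positivity) (fun q hq => ?_) _
  simp only [id, Function.comp]
  rw [deriv_smoothCutoff_of_lt_one, mul_zero, zero_div]
  rwa [div_lt_one (by positivity)]

theorem radialProfile_of_two_mul_le (hε : 0 < ε) (hR : ε ≤ R) {q : ℝ} (hq : 2 * R ^ 2 ≤ q) :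
    radialProfile d ε R q = 0 := by
  have hR0 : 0 < R := by linarith
  unfold radialProfile
  rw [smoothCutoff_of_two_le, smoothCutoff_of_two_le, sub_self, mul_zero]
  · rw [le_div_iff₀ (by positivity)]; nlinarith
  · rw [le_div_iff₀ (by positivity)]; exact hq

theorem averagingProfile_of_two_mul_lt (ht : 0 < t) {q : ℝ} (hq : 2 * t ^ 2 < q) :
    averagingProfile d t q = 0 := by
  unfold averagingProfile
  rw [deriv_smoothCutoff_of_two_lt, mul_zero, zero_div, mul_zero]
  rw [lt_div_iff₀ (by positivity)]; exact hq

theorem averagingProfile_of_lt (ht : 0 < t) {q : ℝ} (hq : q < t ^ 2) :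
    averagingProfile d t q = 0 := by
  unfold averagingProfile
  rw [deriv_smoothCutoff_of_lt_one, mul_zero, zero_div, mul_zero]
  rwa [div_lt_one (by positivity)]

/-- Uniformity in `ε` and `R` is the point: it survives both limits. -/
theorem abs_radialProfile_le {q : ℝ} (hq : 0 ≤ q) :
    |radialProfile d ε R q| ≤ q ^ (-(d / 2)) := by
  unfold radialProfile
  rw [abs_mul, abs_of_nonneg (by positivity)]
  refine mul_le_of_le_one_right (by positivity) (abs_le.2 ⟨?_, ?_⟩)
  · linarith [smoothCutoff_nonneg (q / R ^ 2), smoothCutoff_le_one (q / ε ^ 2)]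
  · linarith [smoothCutoff_nonneg (q / ε ^ 2), smoothCutoff_le_one (q / R ^ 2)]

/-- The profile lives on `t ^ 2 ≤ q ≤ 2 * t ^ 2`, where `q ^ (1 - d / 2) / t ^ 2` is of size `t ^
(-d)`. -/
theorem exists_abs_averagingProfile_le (d : ℝ) :
    ∃ C : ℝ, 0 ≤ C ∧ ∀ t q : ℝ, 0 < t → |averagingProfile d t q| ≤ C * t ^ (-d) := by
  obtain ⟨H, hH⟩ := exists_abs_deriv_smoothCutoff_le
  have hH0 : 0 ≤ H := (abs_nonneg _).trans (hH 0)
  refine ⟨2 ^ |1 - d / 2| * (2 * H), by positivity, fun t q ht => ?_⟩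
  by_cases h1 : q < t ^ 2
  · rw [averagingProfile_of_lt ht h1, abs_zero]; positivity
  by_cases h2 : 2 * t ^ 2 < q
  · rw [averagingProfile_of_two_mul_lt ht h2, abs_zero]; positivity
  push Not at h1 h2
  have hq : 0 < q := lt_of_lt_of_le (by positivity) h1
  unfold averagingProfile
  rw [abs_mul, abs_of_pos (Real.rpow_pos_of_pos hq _), abs_div, abs_mul, abs_of_pos (a := t ^ 2)
    (by positivity), abs_neg, abs_two]
  calc q ^ (1 - d / 2) * (2 * |deriv smoothCutoff (q / t ^ 2)| / t ^ 2)
      ≤ (2 ^ |1 - d / 2| * (t ^ 2) ^ (1 - d / 2)) * (2 * H / t ^ 2) := by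
        gcongr
        · exact rpow_le_of_mem_Icc (by positivity) (by norm_num)
            (by linarith [show 0 < t ^ 2 by positivity]) h2 _
        · exact hH _
    _ = 2 ^ |1 - d / 2| * (2 * H) * ((t ^ 2) ^ (1 - d / 2) / t ^ 2) := by ring
    _ = _ := by
        congr 1
        rw [← Real.rpow_natCast, ← Real.rpow_mul ht.le, ← Real.rpow_sub ht]
        congr 1
        push_cast
        ring

/-- With `q = ‖z‖ ^ 2` the left side is the divergence of `z * f (‖z‖ ^ 2)`. Differentiating `q ^
(-(d / 2))` cancels the term `d * f`, as `z / ‖z‖ ^ d` is divergence free away from 0, and only the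
derivatives of the cutoffs survive. -/
theorem mul_radialProfile_add (hε : 0 < ε) (hR : ε ≤ R) {q : ℝ} (hq : 0 ≤ q) :
    d * radialProfile d ε R q + 2 * q * deriv (radialProfile d ε R) q =
      averagingProfile d ε q - averagingProfile d R q := by
  have hR0 : 0 < R := by linarith
  rcases hq.eq_or_lt with rfl | hq
  · rw [averagingProfile_of_lt hε (by positivity), averagingProfile_of_lt hR0 (by positivity)]
    unfold radialProfile
    rw [zero_div, zero_div]
    simp
  have hd : ∀ t : ℝ, HasDerivAt (fun q => smoothCutoff (q / t ^ 2))
      (deriv smoothCutoff (q / t ^ 2) / t ^ 2) q := fun t => by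
    have h1 : HasDerivAt smoothCutoff _ (q / t ^ 2) :=
      (contDiff_smoothCutoff.differentiable (by simp)).differentiableAt.hasDerivAt
    have := h1.comp q ((hasDerivAt_id q).div_const (t ^ 2))
    simpa [Function.comp_def, div_eq_mul_inv] using this
  have h2 : HasDerivAt (radialProfile d ε R) _ q :=
    (Real.hasDerivAt_rpow_const (p := -(d / 2)) (Or.inl hq.ne')).mul ((hd R).sub (hd ε))
  rw [h2.deriv]
  unfold radialProfile averagingProfile
  have e1 : q ^ (1 - d / 2) = q * q ^ (-(d / 2)) := by
    rw [sub_eq_add_neg, Real.rpow_add hq, Real.rpow_one]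
  rw [e1, Real.rpow_sub_one hq.ne']
  field_simp
  ring

end RadialCutoff

/-! ### Pointwise domination by the Riesz potential of the weak gradient. -/

section GradientRepresentation

variable {N : ℕ} {ε R t : ℝ}

/-- A radial kernel on `ℝ^N` with constant integral, concentrated at scale `t`. -/
noncomputable def averagingKernel (N : ℕ) (t : ℝ) (z : EuclideanSpace ℝ (Fin N)) : ℝ :=
  averagingProfile N t (‖z‖ ^ 2)

theorem continuous_averagingKernel (ht : 0 < t) : Continuous (averagingKernel N t) :=
  (contDiff_averagingProfile ht).continuous.comp (continuous_norm.pow 2)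

theorem averagingKernel_of_lt (ht : 0 < t) {z : EuclideanSpace ℝ (Fin N)} (hz : 2 * t < ‖z‖) :
    averagingKernel N t z = 0 :=
  averagingProfile_of_two_mul_lt ht (by nlinarith)

theorem hasCompactSupport_averagingKernel (ht : 0 < t) (x : EuclideanSpace ℝ (Fin N)) :
    HasCompactSupport fun y => averagingKernel N t (x - y) :=
  HasCompactSupport.intro (isCompact_closedBall x (2 * t)) fun y hy =>
    averagingKernel_of_lt ht (by simpa [dist_eq_norm_sub'] using hy)

/-- In polar coordinates the integrand is minus the derivative of `smoothCutoff (r ^ 2 / t ^ 2)`,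
whose total drop is 1. The area of the unit sphere remains, for every `t`. -/
theorem integral_averagingKernel [NeZero N] (ht : 0 < t) (x : EuclideanSpace ℝ (Fin N)) :
    ∫ y, averagingKernel N t (x - y) =
      N * volume.real (ball (0 : EuclideanSpace ℝ (Fin N)) 1) := by
  have : Nontrivial (EuclideanSpace ℝ (Fin N)) :=
    Module.nontrivial_of_finrank_pos (R := ℝ) (by simpa using NeZero.pos N)
  have hN : 1 ≤ N := NeZero.one_le
  rw [integral_sub_left_eq_self (averagingKernel N t) volume x]
  unfold averagingKernel
  rw [integral_fun_norm_addHaar volume (fun r => averagingProfile N t (r ^ 2))]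
  have hderiv : ∀ r : ℝ, HasDerivAt (fun r => smoothCutoff (r ^ 2 / t ^ 2))
      (deriv smoothCutoff (r ^ 2 / t ^ 2) * (2 * r / t ^ 2)) r := fun r => by
    have h1 : HasDerivAt smoothCutoff _ (r ^ 2 / t ^ 2) :=
      (contDiff_smoothCutoff.differentiable (by simp)).differentiableAt.hasDerivAt
    have := h1.comp r ((hasDerivAt_pow 2 r).div_const (t ^ 2))
    simpa [Function.comp_def] using this
  have hint : ∫ r in Set.Ioi (0 : ℝ), deriv smoothCutoff (r ^ 2 / t ^ 2) * (2 * r / t ^ 2) =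
      0 - smoothCutoff (0 ^ 2 / t ^ 2) := by
    refine integral_Ioi_of_hasDerivAt_of_nonpos (hderiv 0).continuousAt.continuousWithinAt
      (fun r _ => hderiv r) (fun r hr => ?_) ?_
    · have hr : 0 < r := hr
      exact mul_nonpos_of_nonpos_of_nonneg antitone_smoothCutoff.deriv_nonpos (by positivity)
    · refine tendsto_const_nhds.congr' ?_
      filter_upwards [eventually_ge_atTop (2 * t)] with r hr
      rw [smoothCutoff_of_two_le]
      rw [le_div_iff₀ (by positivity)]
      nlinarith
  have hI : ∫ r in Set.Ioi (0 : ℝ), r ^ (Module.finrank ℝ (EuclideanSpace ℝ (Fin N)) - 1) •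
      averagingProfile N t (r ^ 2) = 1 := by
    rw [smoothCutoff_of_le_one (by simp)] at hint
    rw [← neg_eq_iff_eq_neg.2 (hint.trans (zero_sub 1)), ← integral_neg]
    refine setIntegral_congr_fun measurableSet_Ioi fun r hr => ?_
    have hr : 0 < r := hr
    simp only [finrank_euclideanSpace, Fintype.card_fin, averagingProfile, smul_eq_mul]
    have e : r ^ (N - 1) * (r ^ 2) ^ (1 - (N : ℝ) / 2) = r := by
      rw [← Real.rpow_natCast, ← Real.rpow_natCast, ← Real.rpow_mul hr.le, ← Real.rpow_add hr,
        Nat.cast_sub hN]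
      conv_rhs => rw [← Real.rpow_one r]
      congr 1
      push_cast
      ring
    rw [← mul_assoc, e]
    ring
  rw [hI]
  simp

theorem exists_abs_averagingKernel_le (N : ℕ) : ∃ C : ℝ, 0 ≤ C ∧
    ∀ (t : ℝ) (z : EuclideanSpace ℝ (Fin N)), 0 < t → |averagingKernel N t z| ≤ C * t ^ (-(N : ℝ)) := by
  obtain ⟨C, hC, h⟩ := exists_abs_averagingProfile_le N
  exact ⟨C, hC, fun t z ht => h t _ ht⟩

/-- Averages against the averaging kernel are controlled by averages over balls. -/
theorem exists_abs_integral_averagingKernel_le (N : ℕ) [NeZero N] : ∃ C : ℝ, 0 ≤ C ∧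
    ∀ (v : EuclideanSpace ℝ (Fin N) → ℝ) (x : EuclideanSpace ℝ (Fin N)) (t : ℝ), 0 < t →
      LocallyIntegrable v volume →
      |∫ y, v y * averagingKernel N t (x - y)| ≤ C * ⨍ y in closedBall x (2 * t), |v y| := by
  have : Nontrivial (EuclideanSpace ℝ (Fin N)) :=
    Module.nontrivial_of_finrank_pos (R := ℝ) (by simpa using NeZero.pos N)
  obtain ⟨C, hC, h⟩ := exists_abs_averagingKernel_le N
  set V := volume.real (ball (0 : EuclideanSpace ℝ (Fin N)) 1) with hV
  have hV0 : 0 < V := ENNReal.toReal_pos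
    (measure_ball_pos volume _ one_pos).ne' measure_ball_lt_top.ne
  refine ⟨C * (2 ^ N * V), by positivity, fun v x t ht hv => ?_⟩
  have hvi : IntegrableOn (fun y => |v y|) (closedBall x (2 * t)) :=
    (hv.integrableOn_isCompact (isCompact_closedBall _ _)).abs
  have hball : volume.real (closedBall x (2 * t)) = t ^ (N : ℝ) * (2 ^ N * V) := by
    rw [Measure.addHaar_real_closedBall volume x (by positivity), hV, finrank_euclideanSpace,
      Fintype.card_fin, mul_pow, Real.rpow_natCast]
    ring
  calc |∫ y, v y * averagingKernel N t (x - y)|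
      = |∫ y in closedBall x (2 * t), v y * averagingKernel N t (x - y)| := by
        rw [setIntegral_eq_integral_of_forall_compl_eq_zero fun y hy => ?_]
        rw [averagingKernel_of_lt ht, mul_zero]
        simpa [dist_eq_norm_sub'] using hy
    _ ≤ ∫ y in closedBall x (2 * t), |v y| * (C * t ^ (-(N : ℝ))) := by
        rw [← Real.norm_eq_abs]
        refine norm_integral_le_of_norm_le (hvi.mul_const _) (.of_forall fun y => ?_)
        rw [norm_mul, Real.norm_eq_abs, Real.norm_eq_abs]
        exact mul_le_mul_of_nonneg_left (h t _ ht) (abs_nonneg _)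
    _ = _ := by
        rw [integral_mul_const, setAverage_eq, hball, smul_eq_mul, mul_inv, Real.rpow_neg ht.le]
        field_simp

theorem tendsto_integral_averagingKernel_atTop [NeZero N] {u : EuclideanSpace ℝ (Fin N) → ℝ}
    (hu : LocallyIntegrable u volume) (hv : VanishesInMean u) (x : EuclideanSpace ℝ (Fin N)) :
    Tendsto (fun t => ∫ y, u y * averagingKernel N t (x - y)) atTop (𝓝 0) := by
  have : Nontrivial (EuclideanSpace ℝ (Fin N)) :=
    Module.nontrivial_of_finrank_pos (R := ℝ) (by simpa using NeZero.pos N)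
  obtain ⟨C, hC, h⟩ := exists_abs_integral_averagingKernel_le N
  have hlim : Tendsto (fun t : ℝ => C * (2 ^ N *
      ⨍ y in ball (0 : EuclideanSpace ℝ (Fin N)) (4 * t), |u y|)) atTop (𝓝 0) := by
    have : Tendsto (fun t : ℝ => ⨍ y in ball (0 : EuclideanSpace ℝ (Fin N)) (4 * t), |u y|)
        atTop (𝓝 0) := hv.comp (tendsto_id.const_mul_atTop (by norm_num))
    simpa using (this.const_mul ((2 : ℝ) ^ N)).const_mul C
  refine squeeze_zero_norm' ?_ hlim
  -- Once `t > ‖x‖`, the ball of radius `2 * t` about `x` lies in `ball 0 (4 * t)`, at the cost of a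
  -- factor `2 ^ N` in the average.
  filter_upwards [eventually_gt_atTop (‖x‖ + 1)] with t ht
  have ht0 : 0 < t := by linarith [norm_nonneg x]
  refine (h u x t ht0 hu).trans (mul_le_mul_of_nonneg_left ?_ hC)
  rw [setAverage_eq, setAverage_eq, smul_eq_mul, smul_eq_mul,
    show 4 * t = 2 * (2 * t) by ring, measureReal_def volume (ball _ _),
    ← Measure.addHaar_closedBall_eq_addHaar_ball, ← measureReal_def,
    Measure.addHaar_real_closedBall volume x (by positivity),
    Measure.addHaar_real_closedBall volume 0 (by positivity), mul_pow 2 (2 * t), mul_inv, mul_inv, mul_inv,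
    finrank_euclideanSpace, Fintype.card_fin]
  set V := volume.real (ball (0 : EuclideanSpace ℝ (Fin N)) 1) with hV
  have hV0 : 0 < V := ENNReal.toReal_pos
    (measure_ball_pos volume _ one_pos).ne' measure_ball_lt_top.ne
  have hmono : ∫ y in closedBall x (2 * t), |u y| ≤
      ∫ y in ball (0 : EuclideanSpace ℝ (Fin N)) (2 * (2 * t)), |u y| := by
    refine setIntegral_mono_set ?_ (.of_forall fun y => abs_nonneg _) (.of_forall fun y hy => ?_)
    · exact IntegrableOn.mono_set (hu.integrableOn_isCompact
        (isCompact_closedBall 0 (2 * (2 * t)))).abs ball_subset_closedBall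
    · have hy : y ∈ closedBall x (2 * t) := hy
      rw [mem_closedBall_iff_norm] at hy
      have := norm_sub_norm_le y x
      exact mem_ball_zero_iff.2 (by linarith)
  calc _ ≤ ((2 * t) ^ N)⁻¹ * V⁻¹ * ∫ y in ball (0 : EuclideanSpace ℝ (Fin N)) (2 * (2 * t)), |u y| := by
        gcongr
    _ = _ := by field_simp

/-- Because the kernel has constant integral, the error is the integral of `u y - u x` against it,
which is controlled by the mean oscillation at a Lebesgue point. -/
theorem ae_tendsto_integral_averagingKernel [NeZero N] {u : EuclideanSpace ℝ (Fin N) → ℝ}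
    (hu : LocallyIntegrable u volume) :
    ∀ᵐ x, Tendsto (fun t => ∫ y, u y * averagingKernel N t (x - y)) (𝓝[>] 0)
      (𝓝 (u x * (N * volume.real (ball (0 : EuclideanSpace ℝ (Fin N)) 1)))) := by
  obtain ⟨C, hC, h⟩ := exists_abs_integral_averagingKernel_le N
  filter_upwards [IsUnifLocDoublingMeasure.ae_tendsto_average_norm_sub volume hu 1] with x hx
  have hδ : Tendsto (fun t : ℝ => 2 * t) (𝓝[>] 0) (𝓝[>] 0) := by
    refine tendsto_nhdsWithin_iff.2 ⟨?_, ?_⟩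
    · refine tendsto_nhdsWithin_of_tendsto_nhds ?_
      simpa using (tendsto_id (α := ℝ) (x := 𝓝 0)).const_mul 2
    · filter_upwards [self_mem_nhdsWithin] with t ht
      have ht : 0 < t := ht
      exact Set.mem_Ioi.2 (by positivity)
  have hx' := hx (fun _ : ℝ => x) (fun t => 2 * t) hδ (by
    filter_upwards [self_mem_nhdsWithin] with t ht
    have ht : 0 < t := ht
    exact mem_closedBall_self (by positivity))
  rw [tendsto_iff_norm_sub_tendsto_zero]
  refine squeeze_zero' (.of_forall fun _ => norm_nonneg _) ?_ (by simpa using hx'.const_mul C)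
  filter_upwards [self_mem_nhdsWithin] with t ht
  have ht : 0 < t := ht
  refine le_trans (le_of_eq ?_) (h (fun y => u y - u x) x t ht
    (hu.sub (locallyIntegrable_const _)))
  have hk : Continuous fun y => averagingKernel N t (x - y) :=
    (continuous_averagingKernel ht).comp (by fun_prop)
  have hc := hasCompactSupport_averagingKernel ht x
  rw [← integral_averagingKernel ht x, ← integral_const_mul, ← integral_sub, Real.norm_eq_abs]
  · simp only [sub_mul]
  · simpa using hu.integrable_smul_right_of_hasCompactSupport hk hc
  · exact (hk.integrable_of_hasCompactSupport hc).const_mul _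

theorem fderiv_coord_mul_radial {f : ℝ → ℝ} (hf : Differentiable ℝ f)
    (x y : EuclideanSpace ℝ (Fin N)) (i : Fin N) :
    fderiv ℝ (fun y : EuclideanSpace ℝ (Fin N) => (x - y) i * f (‖x - y‖ ^ 2)) y
        (EuclideanSpace.single i 1) =
      -f (‖x - y‖ ^ 2) - 2 * (x - y) i ^ 2 * deriv f (‖x - y‖ ^ 2) := by
  have h0 : HasFDerivAt (fun y : EuclideanSpace ℝ (Fin N) => x - y)
      (-ContinuousLinearMap.id ℝ (EuclideanSpace ℝ (Fin N))) y := by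
    simpa using (hasFDerivAt_id y).const_sub x
  have h1 := (EuclideanSpace.proj (𝕜 := ℝ) i).hasFDerivAt.comp y h0
  have h2 := (hf _).hasDerivAt.comp_hasFDerivAt y h0.norm_sq
  have h3 := h1.mul h2
  have h4 : HasFDerivAt (fun y : EuclideanSpace ℝ (Fin N) => (x - y) i * f (‖x - y‖ ^ 2)) _ y := h3
  have h5 : ∀ v : EuclideanSpace ℝ (Fin N), inner ℝ v (EuclideanSpace.single i (1 : ℝ)) = v i :=
    fun v => by simp [EuclideanSpace.inner_single_right]
  rw [h4.fderiv]
  simp [h5]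
  ring

/-- The coordinates of the truncated field are smooth with compact support, hence admissible test
functions. Summing the weak gradient identity over coordinates produces the divergence on the left
and the inner product on the right. -/
theorem integral_mul_averagingKernel_sub [NeZero N] {u : EuclideanSpace ℝ (Fin N) → ℝ}
    {g : EuclideanSpace ℝ (Fin N) → EuclideanSpace ℝ (Fin N)} (h : HasWeakGradient u g)
    (hε : 0 < ε) (hR : ε ≤ R) (x : EuclideanSpace ℝ (Fin N)) :
    (∫ y, u y * averagingKernel N ε (x - y)) - ∫ y, u y * averagingKernel N R (x - y) =
      ∫ y, inner ℝ (g y) (x - y) * radialProfile N ε R (‖x - y‖ ^ 2) := by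
  have hR0 : 0 < R := by linarith
  set f := radialProfile N ε R with hf
  have hfs : ContDiff ℝ ∞ f := contDiff_radialProfile hε hR
  set φ : Fin N → EuclideanSpace ℝ (Fin N) → ℝ := fun i y => (x - y) i * f (‖x - y‖ ^ 2) with hφ
  have hφs : ∀ i, ContDiff ℝ ∞ (φ i) := fun i =>
    ((EuclideanSpace.proj (𝕜 := ℝ) i).contDiff.comp (contDiff_const.sub contDiff_id)).mul
      (hfs.comp ((contDiff_const.sub contDiff_id).norm_sq ℝ))
  have hφc : ∀ i, HasCompactSupport (φ i) := fun i =>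
    HasCompactSupport.intro (isCompact_closedBall x (2 * R)) fun y hy => by
      have hy : 2 * R < ‖x - y‖ := by simpa [dist_eq_norm_sub'] using hy
      simp only [hφ, hf]
      rw [radialProfile_of_two_mul_le hε hR (by nlinarith), mul_zero]
  have hw := fun i => h.integral_eq (φ i) (hφs i) (hφc i) (EuclideanSpace.single i 1)
  have hsum := Finset.sum_congr (rfl : (Finset.univ : Finset (Fin N)) = _) fun i _ => hw i
  rw [← integral_finsetSum, Finset.sum_neg_distrib, ← integral_finsetSum] at hsum
  · have hd : ∀ y, ∑ i, u y * fderiv ℝ (φ i) y (EuclideanSpace.single i 1) =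
        u y * averagingKernel N R (x - y) - u y * averagingKernel N ε (x - y) := fun y => by
      rw [← Finset.mul_sum, ← mul_sub]
      congr 1
      simp only [hφ, fderiv_coord_mul_radial (hfs.differentiable (by simp))]
      have e := mul_radialProfile_add (d := N) hε hR (sq_nonneg ‖x - y‖)
      rw [Finset.sum_sub_distrib, ← Finset.sum_mul, ← Finset.mul_sum]
      have e2 : ∑ i, (x - y) i ^ 2 = ‖x - y‖ ^ 2 := by
        rw [EuclideanSpace.norm_sq_eq]; simp
      rw [e2]
      simp only [Finset.sum_const, Finset.card_univ, Fintype.card_fin, nsmul_eq_mul]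
      unfold averagingKernel
      rw [← hf] at e
      linarith
    have hg : ∀ y, ∑ i, inner ℝ (g y) (EuclideanSpace.single i (1 : ℝ)) * φ i y =
        inner ℝ (g y) (x - y) * f (‖x - y‖ ^ 2) := fun y => by
      simp only [hφ, ← mul_assoc]
      rw [← Finset.sum_mul]
      congr 1
      rw [PiLp.inner_apply]
      simp [EuclideanSpace.inner_single_right, mul_comm]
    simp_rw [hd, hg] at hsum
    rw [integral_sub] at hsum
    · linarith
    · exact h.locallyIntegrable.integrable_smul_right_of_hasCompactSupport
        ((continuous_averagingKernel hR0).comp (by fun_prop)) (hasCompactSupport_averagingKernel hR0 x)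
    · exact h.locallyIntegrable.integrable_smul_right_of_hasCompactSupport
        ((continuous_averagingKernel hε).comp (by fun_prop)) (hasCompactSupport_averagingKernel hε x)
  · intro i _
    have := (h.locallyIntegrable_grad.integrable_smul_left_of_hasCompactSupport
      (hφs i).continuous (hφc i)).inner_const (𝕜 := ℝ) (EuclideanSpace.single i (1 : ℝ))
    refine this.congr (.of_forall fun y => ?_)
    simp [inner_smul_left, mul_comm]
  · intro i _
    refine h.locallyIntegrable.integrable_smul_right_of_hasCompactSupport
      (((hφs i).continuous_fderiv (by simp)).clm_apply continuous_const) ?_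
    exact ((hφc i).fderiv (𝕜 := ℝ)).comp_left (g := fun L : EuclideanSpace ℝ (Fin N) →L[ℝ] ℝ =>
      L (EuclideanSpace.single i 1)) (by simp)

theorem enorm_integral_mul_averagingKernel_sub_le [NeZero N] {u : EuclideanSpace ℝ (Fin N) → ℝ}
    {g : EuclideanSpace ℝ (Fin N) → EuclideanSpace ℝ (Fin N)} (h : HasWeakGradient u g)
    (hε : 0 < ε) (hR : ε ≤ R) (x : EuclideanSpace ℝ (Fin N)) :
    ‖(∫ y, u y * averagingKernel N ε (x - y)) - ∫ y, u y * averagingKernel N R (x - y)‖ₑ ≤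
      ∫⁻ y, ENNReal.ofReal (‖x - y‖ ^ (1 - (N : ℝ))) * ‖g y‖ₑ := by
  rw [integral_mul_averagingKernel_sub h hε hR x]
  refine (enorm_integral_le_lintegral_enorm _).trans (lintegral_mono fun y => ?_)
  rw [← ofReal_norm, ← ofReal_norm, ← ENNReal.ofReal_mul (by positivity)]
  refine ENNReal.ofReal_le_ofReal ?_
  rcases eq_or_ne (x - y) 0 with h0 | h0
  · rw [h0, inner_zero_right, zero_mul, norm_zero]
    positivity
  have h0 : 0 < ‖x - y‖ := norm_pos_iff.2 h0
  rw [norm_mul]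
  calc ‖inner ℝ (g y) (x - y)‖ * ‖radialProfile N ε R (‖x - y‖ ^ 2)‖
      ≤ (‖g y‖ * ‖x - y‖) * (‖x - y‖ ^ 2) ^ (-((N : ℝ) / 2)) := by
        gcongr
        · exact norm_inner_le_norm _ _
        · exact abs_radialProfile_le (by positivity)
    _ = _ := by
        rw [← Real.rpow_natCast, ← Real.rpow_mul (norm_nonneg _), sub_eq_add_neg 1,
          Real.rpow_add h0, Real.rpow_one]
        have : ((2 : ℕ) : ℝ) * (-((N : ℝ) / 2)) = -N := by push_cast; ring
        rw [this]
        ring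

/-- A function vanishing at infinity in the mean is dominated by the Riesz potential of order one
of its weak gradient. -/
theorem HasWeakGradient.enorm_le_rieszPotential [NeZero N] {u : EuclideanSpace ℝ (Fin N) → ℝ}
    {g : EuclideanSpace ℝ (Fin N) → EuclideanSpace ℝ (Fin N)} (h : HasWeakGradient u g)
    (hu : VanishesInMean u) :
    ∀ᵐ x, ‖u x * (N * volume.real (ball (0 : EuclideanSpace ℝ (Fin N)) 1))‖ₑ ≤
      ∫⁻ y, ENNReal.ofReal (‖x - y‖ ^ (1 - (N : ℝ))) * ‖g y‖ₑ := by
  filter_upwards [ae_tendsto_integral_averagingKernel h.locallyIntegrable] with x hx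
  refine le_of_tendsto hx.enorm ?_
  filter_upwards [self_mem_nhdsWithin] with ε hε
  have hlim := tendsto_integral_averagingKernel_atTop h.locallyIntegrable hu x
  have hlim' := (tendsto_const_nhds (x := ∫ y, u y * averagingKernel N ε (x - y))).sub hlim
  rw [sub_zero] at hlim'
  refine le_of_tendsto hlim'.enorm ?_
  filter_upwards [eventually_ge_atTop ε] with R hR
  exact enorm_integral_mul_averagingKernel_sub_le h hε hR x

end GradientRepresentation

/-! ### From Riesz domination to Hardy inequalities; the gradient case. -/

section HardyMorrey

variable {N : ℕ} {F : Type*} [NormedAddCommGroup F] {p lam : ℝ}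

theorem morreyBound_eMorreyNorm (hp : 0 < p) (f : EuclideanSpace ℝ (Fin N) → F) :
    MorreyBound volume p lam (fun x => ‖f x‖ₑ) (eMorreyNorm p lam f) := fun x r hr => by
  unfold eMorreyNorm
  rw [← ENNReal.rpow_mul, one_div_mul_cancel hp.ne', ENNReal.rpow_one]
  calc ∫⁻ y in ball x r, ‖f y‖ₑ ^ p
      = ENNReal.ofReal (r ^ lam) * (ENNReal.ofReal (r ^ (-lam)) * ∫⁻ y in ball x r, ‖f y‖ₑ ^ p) := by
        rw [← mul_assoc, ← ENNReal.ofReal_mul (by positivity), ← Real.rpow_add hr]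
        simp
    _ ≤ _ := by
        gcongr
        exact le_iSup_of_le x (le_iSup_of_le r (le_iSup_of_le hr le_rfl))

theorem MorreyBound.eMorreyNorm_le (hp : 0 < p) {f : EuclideanSpace ℝ (Fin N) → F} {M : ℝ≥0∞}
    (h : MorreyBound volume p lam (fun x => ‖f x‖ₑ) M) : eMorreyNorm p lam f ≤ M := by
  unfold eMorreyNorm
  rw [one_div, ENNReal.rpow_inv_le_iff hp]
  refine iSup_le fun x => iSup_le fun r => iSup_le fun hr => ?_
  refine (mul_le_mul' le_rfl (h x r hr)).trans_eq ?_
  rw [← mul_assoc, ← ENNReal.ofReal_mul (by positivity), ← Real.rpow_add hr]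
  simp

theorem memMorrey_of_eMorreyNorm_lt_top (hp : 0 < p) {f : EuclideanSpace ℝ (Fin N) → F}
    (hf : AEStronglyMeasurable f volume) (h : eMorreyNorm p lam f < ⊤) : MemMorrey p lam f where
  aestronglyMeasurable := hf
  memLp_compact K hK := by
    refine ⟨hf.restrict, ?_⟩
    rw [eLpNorm_lt_top_iff_lintegral_rpow_enorm_lt_top (by simpa using hp) ENNReal.ofReal_ne_top,
      ENNReal.toReal_ofReal hp.le]
    obtain ⟨r, hr, hKr⟩ := hK.isBounded.subset_ball_lt 0 0
    refine (lintegral_mono_set hKr).trans_lt ((morreyBound_eMorreyNorm (lam := lam) hp f 0 r hr).trans_lt ?_)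
    exact ENNReal.mul_lt_top ENNReal.ofReal_lt_top (ENNReal.rpow_lt_top_of_nonneg hp.le h.ne)
  norm_lt_top := h

/-- A function dominated by the Riesz potential of order `γ` of `f` satisfies a Hardy inequality
in Morrey spaces. -/
theorem exists_hardy_of_le_rieszPotential [NeZero N] [NormedSpace ℝ F] {α β γ : ℝ} (hp : 1 < p)
    (hα : α < N / Real.conjExponent p) (hβ : β < (N - lam) / p) (hγ : α + β = γ) (hγ0 : 0 < γ)
    (hlam : 0 < lam) (hlam' : lam < N) (K : ℝ≥0) :
    ∃ C : ℝ≥0, 0 < C ∧ ∀ (u : EuclideanSpace ℝ (Fin N) → ℝ) (f : EuclideanSpace ℝ (Fin N) → F),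
      AEStronglyMeasurable u volume →
      (∀ᵐ x, ‖u x‖ₑ ≤ K * ∫⁻ y, ENNReal.ofReal (‖x - y‖ ^ (γ - N)) * ‖f y‖ₑ) →
      MemMorrey p lam (fun x => ‖x‖ ^ α • f x) →
      MemMorrey p lam (fun x => ‖x‖ ^ (-β) * u x) ∧
        eMorreyNorm p lam (fun x => ‖x‖ ^ (-β) * u x) ≤
          C * eMorreyNorm p lam (fun x => ‖x‖ ^ α • f x) := by
  have : Nontrivial (EuclideanSpace ℝ (Fin N)) :=
    Module.nontrivial_of_finrank_pos (R := ℝ) (by simpa using NeZero.pos N)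
  have hp0 : 0 < p := by linarith
  have hd : (Module.finrank ℝ (EuclideanSpace ℝ (Fin N)) : ℝ) = N := by simp
  obtain ⟨C, hC⟩ := MorreyBound.weightedRieszPotential
    (μ := (volume : Measure (EuclideanSpace ℝ (Fin N)))) (α := α) (β := β) (γ := γ) hp hlam
    (by rw [hd]; exact hlam'.le) (by
      rw [hd]
      refine hα.trans ?_
      -- The operator bound allows `α` up to `N - N / p + lam / p`, which exceeds `N / p'` by `lam /
      -- p`.
      have : (N : ℝ) / Real.conjExponent p = N - N / p := by
        rw [Real.conjExponent]
        field_simp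
      rw [this, sub_div]
      have : 0 < lam / p := by positivity
      linarith) (by rw [hd]; exact hβ) hγ hγ0
  -- Adding 1 only secures a positive constant.
  refine ⟨K * C + 1, by positivity, fun u f hu huf hf => ?_⟩
  set M := eMorreyNorm p lam (fun x => ‖x‖ ^ α • f x) with hM
  have hb := (hC _ M hf.aestronglyMeasurable.enorm hf.norm_lt_top.ne
    (morreyBound_eMorreyNorm hp0 _)).const_mul hp0.le (c := K) (by simp)
  have hle : eMorreyNorm p lam (fun x => ‖x‖ ^ (-β) * u x) ≤ ((K * C + 1 : ℝ≥0) : ℝ≥0∞) * M := by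
    refine (MorreyBound.eMorreyNorm_le hp0 (hb.mono hp0.le ?_)).trans ?_
    · filter_upwards [huf] with x hx
      rw [enorm_mul, Real.enorm_of_nonneg (by positivity)]
      refine (mul_le_mul' le_rfl hx).trans_eq ?_
      unfold weightedRieszPotential
      rw [mul_left_comm, hd]
      congr 2
      refine lintegral_congr_ae ?_
      have h0 : ∀ᵐ y : EuclideanSpace ℝ (Fin N), y ≠ 0 :=
        compl_mem_ae_iff.2 (measure_singleton 0)
      filter_upwards [h0] with y hy
      rw [enorm_smul, Real.enorm_of_nonneg (by positivity), ← mul_assoc (ENNReal.ofReal (‖y‖ ^ (-α))),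
        ← ENNReal.ofReal_mul (by positivity), ← Real.rpow_add (norm_pos_iff.2 hy)]
      simp
    · rw [← mul_assoc]
      gcongr
      push_cast
      exact le_self_add
  refine ⟨memMorrey_of_eMorreyNorm_lt_top hp0 ?_ (hle.trans_lt
    (ENNReal.mul_lt_top ENNReal.coe_lt_top hf.norm_lt_top)), hle⟩
  have : Measurable fun x : EuclideanSpace ℝ (Fin N) => ‖x‖ ^ (-β) := by fun_prop
  exact this.aestronglyMeasurable.mul hu

theorem exists_weighted_hardy_morrey (N : ℕ) {α β : ℝ} (hp : 1 < p)
    (hα : α < N / Real.conjExponent p) (hβ : β < (N - lam) / p) (hαβ : α + β = 1)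
    (hlam : 0 < lam) (hlam' : lam < N) :
    ∃ C : ℝ≥0, 0 < C ∧ ∀ (u : EuclideanSpace ℝ (Fin N) → ℝ)
      (g : EuclideanSpace ℝ (Fin N) → EuclideanSpace ℝ (Fin N)),
      HasWeakGradient u g → VanishesInMean u →
      MemMorrey p lam (fun x => ‖x‖ ^ α • g x) →
      MemMorrey p lam (fun x => u x / ‖x‖ ^ β) ∧
        eMorreyNorm p lam (fun x => u x / ‖x‖ ^ β) ≤
          C * eMorreyNorm p lam (fun x => ‖x‖ ^ α • g x) := by
  have : NeZero N := ⟨by rintro rfl; norm_num at hlam'; linarith⟩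
  set c : ℝ := N * volume.real (ball (0 : EuclideanSpace ℝ (Fin N)) 1) with hc
  have hc0 : 0 < c := mul_pos (by exact_mod_cast NeZero.pos N)
    (ENNReal.toReal_pos (measure_ball_pos volume _ one_pos).ne' measure_ball_lt_top.ne)
  obtain ⟨C, hC0, hC⟩ := exists_hardy_of_le_rieszPotential (N := N)
    (F := EuclideanSpace ℝ (Fin N)) hp hα hβ hαβ one_pos hlam hlam' c⁻¹.toNNReal
  refine ⟨C, hC0, fun u g hg hu hgM => ?_⟩
  have e : (fun x : EuclideanSpace ℝ (Fin N) => u x / ‖x‖ ^ β) = fun x => ‖x‖ ^ (-β) * u x := by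
    ext x
    rw [Real.rpow_neg (norm_nonneg _), div_eq_inv_mul]
  rw [e]
  refine hC u g hg.locallyIntegrable.aestronglyMeasurable ?_ hgM
  filter_upwards [hg.enorm_le_rieszPotential hu] with x hx
  rw [← hc, enorm_mul, Real.enorm_of_nonneg hc0.le] at hx
  calc ‖u x‖ₑ = ENNReal.ofReal c⁻¹ * (‖u x‖ₑ * ENNReal.ofReal c) := by
        rw [mul_left_comm, ← ENNReal.ofReal_mul (by positivity), inv_mul_cancel₀ hc0.ne']
        simp
    _ ≤ _ := mul_le_mul' le_rfl hx

theorem exists_hardy_morrey (N : ℕ) (hp : 1 < p) (hlam : 0 < lam) (hlam' : lam < N - p) :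
    ∃ C : ℝ≥0, 0 < C ∧ ∀ (u : EuclideanSpace ℝ (Fin N) → ℝ)
      (g : EuclideanSpace ℝ (Fin N) → EuclideanSpace ℝ (Fin N)),
      HasWeakGradient u g → VanishesInMean u → MemMorrey p lam g →
      MemMorrey p lam (fun x => u x / ‖x‖) ∧
        eMorreyNorm p lam (fun x => u x / ‖x‖) ≤ C * eMorreyNorm p lam g := by
  have hpc : 0 < Real.conjExponent p := (Real.HolderConjugate.conjExponent hp).symm.pos
  have hN : (0 : ℝ) < N := by linarith
  have hp0 : 0 < p := by linarith
  simpa using exists_weighted_hardy_morrey N (α := 0) (β := 1) hp (by positivity)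
    (by rw [lt_div_iff₀ hp0]; linarith) (by norm_num) hlam (by linarith)

end HardyMorrey

/-! ### The symbol of the second-difference operator. -/

section CosineIntegral

variable {N : ℕ} {γ : ℝ}

/-- Near 0 the function is `‖y‖ ^ (1 - N - γ)`, integrable since `γ < 1`; at infinity it is `‖y‖ ^
(-N - γ)`, integrable since `γ > 0`. As `γ < 1`, first-order cancellation suffices throughout. -/
theorem integrable_min_one_norm_div_rpow [NeZero N] (hγ : 0 < γ) (hγ1 : γ < 1) :
    Integrable fun y : EuclideanSpace ℝ (Fin N) => min 1 ‖y‖ / ‖y‖ ^ ((N : ℝ) + γ) := by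
  have : Nontrivial (EuclideanSpace ℝ (Fin N)) :=
    Module.nontrivial_of_finrank_pos (R := ℝ) (by simpa using NeZero.pos N)
  have hd : (Module.finrank ℝ (EuclideanSpace ℝ (Fin N)) : ℝ) = N := by simp
  obtain ⟨C, hC⟩ := setLIntegral_ball_rpow_norm_le
    (μ := (volume : Measure (EuclideanSpace ℝ (Fin N)))) (a := 1 - ((N : ℝ) + γ))
    (by rw [hd]; linarith)
  refine ⟨(Measurable.aestronglyMeasurable (by fun_prop)), ?_⟩
  rw [hasFiniteIntegral_iff_ofReal (.of_forall fun y => by positivity),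
    ← lintegral_add_compl _ (measurableSet_ball (x := (0 : EuclideanSpace ℝ (Fin N))) (ε := 1))]
  refine ENNReal.add_lt_top.2 ⟨?_, ?_⟩
  · refine lt_of_le_of_lt (lintegral_mono fun y => ?_) ((hC 1 one_pos).trans_lt
      (ENNReal.mul_lt_top ENNReal.ofReal_lt_top ENNReal.coe_lt_top))
    refine ENNReal.ofReal_le_ofReal ?_
    rcases eq_or_ne y 0 with rfl | hy
    · simp; positivity
    have hy := norm_pos_iff.2 hy
    rw [Real.rpow_sub hy, Real.rpow_one]
    gcongr
    exact min_le_right _ _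
  · have hH : ∀ ρ : ℝ, 0 < ρ → ∫⁻ y in closedAnnulus (EuclideanSpace ℝ (Fin N)) ρ,
        ENNReal.ofReal (‖y‖ ^ (-((N : ℝ) + γ))) * 1 ≤
        ENNReal.ofReal (ρ ^ (-γ)) * (ENNReal.ofReal (2 ^ |(-((N : ℝ) + γ))| * 3 ^ (N : ℝ)) *
          volume (ball (0 : EuclideanSpace ℝ (Fin N)) 1)) := fun ρ hρ => by
      refine (setLIntegral_closedAnnulus_rpow_mul_le hρ _).trans ?_
      have hsub : closedAnnulus (EuclideanSpace ℝ (Fin N)) ρ ⊆ ball 0 (3 * ρ) := fun y hy => by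
        rw [mem_ball_zero_iff]; linarith [hy.2]
      rw [setLIntegral_const, one_mul]
      refine (mul_le_mul' le_rfl (measure_mono hsub)).trans_eq ?_
      rw [addHaar_ball_rpow _ (by positivity), ← mul_assoc, ← mul_assoc, hd,
        ← ENNReal.ofReal_mul (by positivity), ← ENNReal.ofReal_mul (by positivity),
        Real.mul_rpow (by norm_num) hρ.le]
      congr 2
      have : ρ ^ (-γ) = ρ ^ (-((N : ℝ) + γ)) * ρ ^ (N : ℝ) := by
        rw [← Real.rpow_add hρ]; ring_nf
      rw [this]
      ring
    have h := setLIntegral_compl_ball_le_of_closedAnnulus (by linarith : -γ < 0) hH one_pos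
    refine lt_of_le_of_lt (lintegral_mono fun y => ?_) (h.trans_lt (ENNReal.mul_lt_top
      ENNReal.ofReal_lt_top (ENNReal.mul_lt_top ENNReal.ofReal_lt_top measure_ball_lt_top)))
    rw [mul_one, Real.rpow_neg (norm_nonneg _), inv_eq_one_div]
    refine ENNReal.ofReal_le_ofReal ?_
    gcongr
    exact min_le_left _ _

theorem two_sub_two_mul_cos_le (θ : ℝ) : 2 - 2 * Real.cos θ ≤ 2 * |θ| := by
  have h1 := Real.one_sub_sq_div_two_le_cos (x := θ)
  have h2 := Real.neg_one_le_cos θ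
  rcases le_total |θ| 2 with h | h
  · nlinarith [sq_abs θ, abs_nonneg θ]
  · linarith

/-- The Lévy kernel of the fractional Laplacian on the Fourier side. -/
noncomputable def cosKernel (γ : ℝ) (ξ y : EuclideanSpace ℝ (Fin N)) : ℝ :=
  (2 - 2 * Real.cos (2 * Real.pi * inner ℝ ξ y)) / ‖y‖ ^ ((N : ℝ) + γ)

theorem cosKernel_nonneg (ξ y : EuclideanSpace ℝ (Fin N)) : 0 ≤ cosKernel γ ξ y :=
  div_nonneg (by linarith [Real.cos_le_one (2 * Real.pi * inner ℝ ξ y)]) (by positivity)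

theorem measurable_cosKernel :
    Measurable fun q : EuclideanSpace ℝ (Fin N) × EuclideanSpace ℝ (Fin N) =>
      cosKernel γ q.1 q.2 := by
  unfold cosKernel
  fun_prop

theorem integrable_cosKernel [NeZero N] (hγ : 0 < γ) (hγ1 : γ < 1) (ξ : EuclideanSpace ℝ (Fin N)) :
    Integrable (cosKernel γ ξ) := by
  refine ((integrable_min_one_norm_div_rpow (N := N) hγ hγ1).const_mul
    (4 + 4 * Real.pi * ‖ξ‖)).mono' ?_ (.of_forall fun y => ?_)
  · exact (measurable_cosKernel.comp measurable_prodMk_left).aestronglyMeasurable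
  · rw [Real.norm_of_nonneg (cosKernel_nonneg _ _), cosKernel, ← mul_div_assoc]
    gcongr
    have hπ := Real.pi_pos
    rcases min_cases 1 ‖y‖ with ⟨h, _⟩ | ⟨h, _⟩
    · rw [h]
      have : 0 ≤ 4 * Real.pi * ‖ξ‖ := by positivity
      linarith [Real.neg_one_le_cos (2 * Real.pi * inner ℝ ξ y)]
    · rw [h]
      refine (two_sub_two_mul_cos_le _).trans ?_
      rw [abs_mul, abs_of_pos (by positivity)]
      have h1 := abs_real_inner_le_norm ξ y
      have h2 := norm_nonneg y
      nlinarith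

/-- A reflection carries `ξ` to `‖ξ‖ • e`, and a dilation by `‖ξ‖` removes the length: the kernel
contributes `‖ξ‖ ^ (N + γ)` and the Jacobian `‖ξ‖ ^ (-N)`. -/
theorem integral_cosKernel_eq {e : EuclideanSpace ℝ (Fin N)} (he : ‖e‖ = 1) (hγ : 0 < γ)
    (ξ : EuclideanSpace ℝ (Fin N)) :
    ∫ y, cosKernel γ ξ y = (∫ y, cosKernel γ e y) * ‖ξ‖ ^ γ := by
  rcases eq_or_ne ξ 0 with rfl | hξ
  · simp [cosKernel, Real.zero_rpow hγ.ne']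
  have hξ0 : 0 < ‖ξ‖ := norm_pos_iff.2 hξ
  set ρ := (ℝ ∙ (ξ - ‖ξ‖ • e))ᗮ.reflection with hρ
  have hρξ : ρ ξ = ‖ξ‖ • e := Submodule.reflection_sub (by rw [norm_smul, he]; simp)
  have h1 : ∀ y, cosKernel γ ξ y = ‖ξ‖ ^ ((N : ℝ) + γ) * cosKernel γ e (‖ξ‖ • ρ y) := fun y => by
    have e1 : inner ℝ ξ y = inner ℝ e (‖ξ‖ • ρ y) := by
      rw [← ρ.inner_map_map ξ y, hρξ, inner_smul_left, inner_smul_right]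
      simp
    have e2 : ‖‖ξ‖ • ρ y‖ = ‖ξ‖ * ‖y‖ := by
      rw [norm_smul, ρ.norm_map]; simp
    unfold cosKernel
    rw [e2, ← e1, Real.mul_rpow hξ0.le (norm_nonneg _)]
    field_simp
  simp_rw [h1]
  rw [integral_const_mul, (ρ.measurePreserving).integral_comp
    ρ.toHomeomorph.measurableEmbedding (fun y => cosKernel γ e (‖ξ‖ • y)),
    Measure.integral_comp_smul, finrank_euclideanSpace, Fintype.card_fin,
    abs_of_nonneg (by positivity), Real.rpow_add hξ0, Real.rpow_natCast, smul_eq_mul]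
  field_simp

theorem exists_integral_cosKernel_eq (N : ℕ) [NeZero N] (hγ : 0 < γ) (hγ1 : γ < 1) :
    ∃ κ : ℝ, 0 < κ ∧ ∀ ξ : EuclideanSpace ℝ (Fin N), ∫ y, cosKernel γ ξ y = κ * ‖ξ‖ ^ γ := by
  set e : EuclideanSpace ℝ (Fin N) := EuclideanSpace.single 0 1 with he
  have he1 : ‖e‖ = 1 := by simp [he]
  refine ⟨_, ?_, integral_cosKernel_eq he1 hγ⟩
  rw [integral_pos_iff_support_of_nonneg (fun y => cosKernel_nonneg _ _)
    (integrable_cosKernel hγ hγ1 e)]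
  set S : Set (EuclideanSpace ℝ (Fin N)) := {y | Real.cos (2 * Real.pi * inner ℝ e y) < 1} with hS
  have hSo : IsOpen S := isOpen_lt (by fun_prop) continuous_const
  -- Positivity needs only a nonempty open set where the cosine is below 1; at `e / 2` it equals
  -- `cos π`.
  refine lt_of_lt_of_le (hSo.measure_pos volume ⟨(1 / 2 : ℝ) • e, ?_⟩) (measure_mono fun y hy => ?_)
  · have : (2 * Real.pi * inner ℝ e ((1 / 2 : ℝ) • e)) = Real.pi := by
      rw [inner_smul_right, real_inner_self_eq_norm_sq, he1]; ring
    simp only [hS, Set.mem_ofPred_eq, this, Real.cos_pi]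
    norm_num
  · have hy : Real.cos (2 * Real.pi * inner ℝ e y) < 1 := hy
    have hy0 : y ≠ 0 := by rintro rfl; simp at hy
    have hy0 := norm_pos_iff.2 hy0
    refine (div_pos ?_ (by positivity)).ne'
    linarith

end CosineIntegral

/-! ### The fractional Laplacian on the Fourier side. -/

section FractionalLaplacianFourier

open scoped FourierTransform

variable {N : ℕ} {γ : ℝ}

/-- A real Schwartz function regarded as a complex one. -/
noncomputable def schwartzOfReal (u : 𝓢(EuclideanSpace ℝ (Fin N), ℝ)) :
    𝓢(EuclideanSpace ℝ (Fin N), ℂ) :=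
  SchwartzMap.postcompCLM (𝕜 := ℝ) Complex.ofRealCLM u

theorem schwartzOfReal_apply (u : 𝓢(EuclideanSpace ℝ (Fin N), ℝ)) (x : EuclideanSpace ℝ (Fin N)) :
    schwartzOfReal u x = u x := rfl

theorem integrable_exp_mul {h : EuclideanSpace ℝ (Fin N) → ℂ} (hh : Integrable h)
    (z : EuclideanSpace ℝ (Fin N)) :
    Integrable fun ξ => Complex.exp (↑(2 * Real.pi * inner ℝ ξ z) * Complex.I) * h ξ :=
  hh.bdd_mul (c := 1) (Continuous.aestronglyMeasurable (by fun_prop))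
    (.of_forall fun ξ => by rw [Complex.norm_exp_ofReal_mul_I])

theorem SchwartzMap.eq_integral_exp_mul_fourier (U : 𝓢(EuclideanSpace ℝ (Fin N), ℂ))
    (z : EuclideanSpace ℝ (Fin N)) :
    U z = ∫ ξ, Complex.exp (↑(2 * Real.pi * inner ℝ ξ z) * Complex.I) * 𝓕 U ξ := by
  have h := Continuous.fourierInv_fourier_eq U.continuous U.integrable
    (by rw [← SchwartzMap.fourier_coe]; exact (𝓕 U).integrable)
  conv_lhs => rw [← h]
  rw [Real.fourierInv_eq']
  rfl

theorem second_difference_eq_integral_fourier (u : 𝓢(EuclideanSpace ℝ (Fin N), ℝ))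
    (x y : EuclideanSpace ℝ (Fin N)) :
    ((2 * u x - u (x + y) - u (x - y) : ℝ) : ℂ) =
      ∫ ξ, ((2 - 2 * Real.cos (2 * Real.pi * inner ℝ ξ y) : ℝ) : ℂ) *
        (Complex.exp (↑(2 * Real.pi * inner ℝ ξ x) * Complex.I) * 𝓕 (schwartzOfReal u) ξ) := by
  set U := schwartzOfReal u
  set e : EuclideanSpace ℝ (Fin N) → EuclideanSpace ℝ (Fin N) → ℂ := fun z ξ =>
    Complex.exp (↑(2 * Real.pi * inner ℝ ξ z) * Complex.I) * 𝓕 U ξ with he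
  have hi : ∀ z, Integrable (e z) := fun z => integrable_exp_mul (𝓕 U).integrable z
  have hU : ∀ z, ((u z : ℝ) : ℂ) = ∫ ξ, e z ξ := fun z => U.eq_integral_exp_mul_fourier z
  have hs : Integrable fun ξ => 2 * e x ξ - e (x + y) ξ := ((hi x).const_mul 2).sub (hi _)
  push_cast
  rw [hU x, hU (x + y), hU (x - y), ← integral_const_mul, ← integral_sub ((hi x).const_mul 2)
    (hi _), ← integral_sub hs (hi _)]
  refine integral_congr_ae (.of_forall fun ξ => ?_)
  simp only [he]
  rw [inner_add_right, inner_sub_right, Complex.cos]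
  have e1 : Complex.exp (↑(2 * Real.pi * (inner ℝ ξ x + inner ℝ ξ y)) * Complex.I) =
      Complex.exp (↑(2 * Real.pi * inner ℝ ξ x) * Complex.I) *
        Complex.exp (2 * Real.pi * inner ℝ ξ y * Complex.I) := by
    rw [← Complex.exp_add]; congr 1; push_cast; ring
  have e2 : Complex.exp (↑(2 * Real.pi * (inner ℝ ξ x - inner ℝ ξ y)) * Complex.I) =
      Complex.exp (↑(2 * Real.pi * inner ℝ ξ x) * Complex.I) *
        Complex.exp (-(2 * Real.pi * inner ℝ ξ y) * Complex.I) := by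
    rw [← Complex.exp_add]; congr 1; push_cast; ring
  rw [e1, e2]
  push_cast
  ring

theorem integrable_rpow_norm_mul (V : 𝓢(EuclideanSpace ℝ (Fin N), ℂ)) (hγ : 0 < γ) (hγ1 : γ < 1) :
    Integrable fun ξ => ((‖ξ‖ ^ γ : ℝ) : ℂ) * V ξ := by
  refine ((V.integrable.norm).add (by simpa using V.integrable_pow_mul volume 1)).mono' ?_ ?_
  · refine AEStronglyMeasurable.mul ?_ V.continuous.aestronglyMeasurable
    exact (Measurable.aestronglyMeasurable (by fun_prop))
  · refine .of_forall fun ξ => ?_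
    rw [norm_mul, Complex.norm_real, Real.norm_of_nonneg (by positivity), Pi.add_apply]
    have : ‖ξ‖ ^ γ ≤ 1 + ‖ξ‖ := by
      calc ‖ξ‖ ^ γ ≤ (1 + ‖ξ‖) ^ γ := by gcongr; linarith
        _ ≤ (1 + ‖ξ‖) ^ (1 : ℝ) := Real.rpow_le_rpow_of_exponent_le
            (by linarith [norm_nonneg ξ]) hγ1.le
        _ = _ := Real.rpow_one _
    nlinarith [norm_nonneg (V ξ)]

/-- Tonelli with `y` integrated first: positivity of the kernel turns the inner integral into `κ *
‖ξ‖ ^ γ * ‖e ξ‖`. This licenses exchanging the second-difference and Fourier integrals. -/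
theorem integrable_cosKernel_mul [NeZero N] (hγ : 0 < γ) (hγ1 : γ < 1) {κ : ℝ}
    (hκ : ∀ ξ : EuclideanSpace ℝ (Fin N), ∫ y, cosKernel γ ξ y = κ * ‖ξ‖ ^ γ)
    {e : EuclideanSpace ℝ (Fin N) → ℂ} (he : AEStronglyMeasurable e)
    (hγe : Integrable fun ξ => ‖ξ‖ ^ γ * ‖e ξ‖) :
    Integrable (Function.uncurry fun y ξ : EuclideanSpace ℝ (Fin N) =>
      ((cosKernel γ ξ y : ℝ) : ℂ) * e ξ) (volume.prod volume) := by
  have hcos : Measurable fun q : EuclideanSpace ℝ (Fin N) × EuclideanSpace ℝ (Fin N) =>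
      ((cosKernel γ q.2 q.1 : ℝ) : ℂ) := by
    unfold cosKernel
    fun_prop
  have hmeas : AEStronglyMeasurable (fun q : EuclideanSpace ℝ (Fin N) × EuclideanSpace ℝ (Fin N) =>
      ((cosKernel γ q.2 q.1 : ℝ) : ℂ) * e q.2) (volume.prod volume) :=
    hcos.aestronglyMeasurable.mul he.comp_snd
  have hξ : ∀ ξ, Integrable fun y => ((cosKernel γ ξ y : ℝ) : ℂ) * e ξ := fun ξ =>
    Integrable.mul_const (Integrable.ofReal (𝕜 := ℂ) (integrable_cosKernel hγ hγ1 ξ)) _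
  refine (integrable_prod_iff' hmeas).2 ⟨.of_forall hξ, ?_⟩
  refine (hγe.const_mul κ).congr (.of_forall fun ξ => ?_)
  have hn : ∀ y, ‖((cosKernel γ ξ y : ℝ) : ℂ) * e ξ‖ = cosKernel γ ξ y * ‖e ξ‖ := fun y => by
    rw [norm_mul, Complex.norm_real, Real.norm_of_nonneg (cosKernel_nonneg _ _)]
  simp only [hn]
  rw [integral_mul_const, hκ, mul_assoc]

/-- The fractional Laplacian of a Schwartz function is a multiple of the inverse Fourier transform
of `‖ξ‖ ^ γ * 𝓕 u ξ`. -/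
theorem fracLaplacian_eq_integral_fourier [NeZero N] (hγ : 0 < γ) (hγ1 : γ < 1) {κ : ℝ}
    (hκ : ∀ ξ : EuclideanSpace ℝ (Fin N), ∫ y, cosKernel γ ξ y = κ * ‖ξ‖ ^ γ)
    (u : 𝓢(EuclideanSpace ℝ (Fin N), ℝ)) (x : EuclideanSpace ℝ (Fin N)) :
    ((fracLaplacian (γ / 2) u x : ℝ) : ℂ) = ((fracLaplacianConst N (γ / 2) / 2 * κ : ℝ) : ℂ) *
      ∫ ξ, Complex.exp (↑(2 * Real.pi * inner ℝ ξ x) * Complex.I) *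
        (((‖ξ‖ ^ γ : ℝ) : ℂ) * 𝓕 (schwartzOfReal u) ξ) := by
  obtain ⟨V, hV⟩ : ∃ V, V = 𝓕 (schwartzOfReal u) := ⟨_, rfl⟩
  set e : EuclideanSpace ℝ (Fin N) → ℂ := fun ξ =>
    Complex.exp (↑(2 * Real.pi * inner ℝ ξ x) * Complex.I) * V ξ with he
  have hei : Integrable e := integrable_exp_mul V.integrable x
  have hprod := integrable_cosKernel_mul hγ hγ1 hκ hei.aestronglyMeasurable
    ((integrable_rpow_norm_mul V hγ hγ1).norm.congr (.of_forall fun ξ => by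
      simp only [he]
      rw [norm_mul, norm_mul, Complex.norm_exp_ofReal_mul_I, one_mul, Complex.norm_real,
        Real.norm_of_nonneg (by positivity)]))
  have hfrac : ∀ y : EuclideanSpace ℝ (Fin N),
      (((2 * u x - u (x + y) - u (x - y)) / ‖y‖ ^ ((N : ℝ) + 2 * (γ / 2)) : ℝ) : ℂ) =
        ∫ ξ, ((cosKernel γ ξ y : ℝ) : ℂ) * e ξ := fun y => by
    rw [show (N : ℝ) + 2 * (γ / 2) = N + γ by ring, Complex.ofReal_div,
      second_difference_eq_integral_fourier, ← integral_div]
    refine integral_congr_ae (.of_forall fun ξ => ?_)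
    simp only [cosKernel, he, hV]
    rw [Complex.ofReal_div]
    ring
  have hint : ((∫ y, (2 * u x - u (x + y) - u (x - y)) / ‖y‖ ^ ((N : ℝ) + 2 * (γ / 2)) : ℝ) : ℂ) =
      ∫ ξ, ((κ * ‖ξ‖ ^ γ : ℝ) : ℂ) * e ξ := by
    refine integral_complex_ofReal.symm.trans ?_
    rw [integral_congr_ae (.of_forall hfrac), integral_integral_swap hprod]
    refine integral_congr_ae (.of_forall fun ξ => ?_)
    simp only
    rw [integral_mul_const, integral_complex_ofReal, hκ]
  rw [fracLaplacian, Complex.ofReal_mul, hint, Complex.ofReal_mul (_ / 2) κ, mul_assoc, ← hV]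
  congr 1
  rw [← integral_const_mul]
  refine integral_congr_ae (.of_forall fun ξ => ?_)
  simp only [he]
  rw [Complex.ofReal_mul]
  ring

theorem fracLaplacianConst_pos [NeZero N] (hγ : 0 < γ) (hγ1 : γ < 1) :
    0 < fracLaplacianConst N (γ / 2) := by
  have h1 : 0 < Real.Gamma ((N : ℝ) / 2 + γ / 2) := Real.Gamma_pos_of_pos (by positivity)
  have h2 : 0 < Real.Gamma (1 - γ / 2) := Real.Gamma_pos_of_pos (by linarith)
  unfold fracLaplacianConst
  positivity

/-- Pairing the fractional Laplacian with a Gaussian. -/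
theorem integral_gaussian_mul_fracLaplacian [NeZero N] (hγ : 0 < γ) (hγ1 : γ < 1) {κ : ℝ}
    (hκ : ∀ ξ : EuclideanSpace ℝ (Fin N), ∫ y, cosKernel γ ξ y = κ * ‖ξ‖ ^ γ)
    (u : 𝓢(EuclideanSpace ℝ (Fin N), ℝ)) {t : ℝ} (ht : 0 < t) :
    ∫ x, ((Real.exp (-(Real.pi * ‖x‖ ^ 2 * t)) * fracLaplacian (γ / 2) u x : ℝ) : ℂ) =
      ((fracLaplacianConst N (γ / 2) / 2 * κ : ℝ) : ℂ) *
      ∫ ξ, ((t ^ (-((N : ℝ) / 2)) * Real.exp (-(Real.pi * ‖ξ‖ ^ 2 * t⁻¹)) : ℝ) : ℂ) *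
        (((‖ξ‖ ^ γ : ℝ) : ℂ) * 𝓕 (schwartzOfReal u) ξ) := by
  set V := 𝓕 (schwartzOfReal u) with hV
  set c := fracLaplacianConst N (γ / 2) / 2 * κ with hc
  set G : EuclideanSpace ℝ (Fin N) → ℂ := fun x => Complex.exp (-(Real.pi * t : ℂ) * ‖x‖ ^ 2) with hG
  have hre : 0 < (Real.pi * t : ℂ).re := by
    rw [← Complex.ofReal_mul, Complex.ofReal_re]; positivity
  have hGi : Integrable G := by
    have := GaussianFourier.integrable_cexp_neg_mul_sq_norm_add (V := EuclideanSpace ℝ (Fin N))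
      hre 0 0
    simpa [hG] using this
  have hhi := integrable_rpow_norm_mul V hγ hγ1
  set h : EuclideanSpace ℝ (Fin N) → ℂ := fun ξ => ((‖ξ‖ ^ γ : ℝ) : ℂ) * V ξ with hh
  have hprod : Integrable (Function.uncurry fun x ξ : EuclideanSpace ℝ (Fin N) =>
      Complex.exp (↑(2 * Real.pi * inner ℝ ξ x) * Complex.I) * (G x * h ξ))
      (volume.prod volume) := by
    refine (hGi.mul_prod hhi).bdd_mul (c := 1) (Continuous.aestronglyMeasurable (by fun_prop))
      (.of_forall fun q => by rw [Complex.norm_exp_ofReal_mul_I])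
  have hleft : ∀ x, ((Real.exp (-(Real.pi * ‖x‖ ^ 2 * t)) * fracLaplacian (γ / 2) u x : ℝ) : ℂ) =
      c * ∫ ξ, Complex.exp (↑(2 * Real.pi * inner ℝ ξ x) * Complex.I) * (G x * h ξ) := fun x => by
    rw [Complex.ofReal_mul, fracLaplacian_eq_integral_fourier hγ hγ1 hκ, mul_left_comm,
      ← integral_const_mul]
    congr 1
    refine integral_congr_ae (.of_forall fun ξ => ?_)
    simp only [hG, hh, hV]
    push_cast
    ring_nf
  simp_rw [hleft]
  rw [integral_const_mul, integral_integral_swap hprod]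
  congr 1
  refine integral_congr_ae (.of_forall fun ξ => ?_)
  -- The exponential carries a plus sign, so the Fourier transform of the Gaussian is taken at `-ξ`.
  have hF := fourier_gaussian_innerProductSpace hre (-ξ)
  rw [Real.fourier_eq'] at hF
  simp only
  calc ∫ x, Complex.exp (↑(2 * Real.pi * inner ℝ ξ x) * Complex.I) * (G x * h ξ)
      = (∫ x, Complex.exp (↑(-2 * Real.pi * inner ℝ x (-ξ)) * Complex.I) • G x) * h ξ := by
        rw [← integral_mul_const]
        refine integral_congr_ae (.of_forall fun x => ?_)
        simp only [inner_neg_right, real_inner_comm, smul_eq_mul]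
        rw [real_inner_comm]
        ring_nf
    _ = _ := by
        rw [hF, norm_neg, finrank_euclideanSpace, Fintype.card_fin]
        congr 1
        have hpi : (Real.pi : ℂ) ≠ 0 := by exact_mod_cast Real.pi_pos.ne'
        have htc : (t : ℂ) ≠ 0 := by exact_mod_cast ht.ne'
        rw [Complex.ofReal_mul, Real.rpow_neg ht.le, ← Real.inv_rpow ht.le,
          Complex.ofReal_cpow (by positivity)]
        congr 1
        · push_cast
          congr 1
          field_simp
        · push_cast
          congr 1
          field_simp

end FractionalLaplacianFourier

/-! ### Integrability and boundedness of the fractional Laplacian. -/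

section FractionalLaplacianIntegrable

variable {N : ℕ} {γ : ℝ}

/-- `G` is a multiple of `(1 + ‖x‖) ^ (-(N + 1))`. For `‖y‖ ≤ 1` the mean value inequality applies,
with `1 + ‖x‖ ≤ 2 * (1 + ‖z‖)` on the ball, whence the power of 2; for larger `y` both values are
bounded separately. -/
theorem SchwartzMap.exists_abs_sub_le_min_one_norm (u : 𝓢(EuclideanSpace ℝ (Fin N), ℝ)) :
    ∃ G : EuclideanSpace ℝ (Fin N) → ℝ, Measurable G ∧ Integrable G ∧ (∀ x, 0 ≤ G x) ∧
      ∀ x y, |u (x + y) - u x| ≤ min 1 ‖y‖ * (G x + G (x + y)) := by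
  set C := 2 ^ (N + 1) *
    ((Finset.Iic (N + 1, 1)).sup fun m => SchwartzMap.seminorm ℝ m.1 m.2) u with hC
  have h0 : ∀ x, (1 + ‖x‖) ^ (N + 1) * |u x| ≤ C := fun x => by
    simpa using SchwartzMap.one_add_le_sup_seminorm_apply (𝕜 := ℝ) (m := (N + 1, 1)) (k := N + 1)
      (n := 0) le_rfl zero_le_one u x
  have h1 : ∀ x, (1 + ‖x‖) ^ (N + 1) * ‖fderiv ℝ u x‖ ≤ C := fun x => by
    rw [← norm_iteratedFDeriv_one]
    exact SchwartzMap.one_add_le_sup_seminorm_apply (𝕜 := ℝ) (m := (N + 1, 1)) (k := N + 1)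
      (n := 1) le_rfl le_rfl u x
  have hC0 : 0 ≤ C := le_trans (by positivity) (h0 0)
  have hG : ∀ x : EuclideanSpace ℝ (Fin N), (1 + ‖x‖) ^ (-((N : ℝ) + 1)) = ((1 + ‖x‖) ^ (N + 1))⁻¹ :=
    fun x => by
      rw [Real.rpow_neg (by positivity), ← Real.rpow_natCast]
      push_cast
      rfl
  refine ⟨fun x => 2 ^ (N + 1) * C * (1 + ‖x‖) ^ (-((N : ℝ) + 1)), by fun_prop, ?_,
    fun x => by positivity, fun x y => ?_⟩
  · exact (integrable_one_add_norm (by simp)).const_mul _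
  simp only [hG]
  rcases le_total ‖y‖ 1 with hy | hy
  · rw [min_eq_right hy]
    have hb : ∀ z ∈ closedBall x ‖y‖, ‖fderiv ℝ u z‖ ≤ 2 ^ (N + 1) * C * ((1 + ‖x‖) ^ (N + 1))⁻¹ :=
      fun z hz => by
        rw [mem_closedBall_iff_norm'] at hz
        have h2 := norm_sub_norm_le x z
        rw [← div_eq_mul_inv, le_div_iff₀ (by positivity)]
        calc ‖fderiv ℝ u z‖ * (1 + ‖x‖) ^ (N + 1)
            ≤ ‖fderiv ℝ u z‖ * (2 * (1 + ‖z‖)) ^ (N + 1) := by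
              gcongr
              linarith [norm_nonneg z]
          _ = 2 ^ (N + 1) * ((1 + ‖z‖) ^ (N + 1) * ‖fderiv ℝ u z‖) := by rw [mul_pow]; ring
          _ ≤ _ := by gcongr; exact h1 z
    have := (convex_closedBall x ‖y‖).norm_image_sub_le_of_norm_fderiv_le
      (fun z _ => u.differentiableAt) hb (mem_closedBall_self (norm_nonneg y))
      (y := x + y) (by simp)
    rw [Real.norm_eq_abs, add_sub_cancel_left] at this
    refine this.trans ?_
    rw [mul_comm]
    gcongr
    exact le_add_of_nonneg_right (by positivity)
  · rw [min_eq_left hy, one_mul]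
    have hb : ∀ z, |u z| ≤ 2 ^ (N + 1) * C * ((1 + ‖z‖) ^ (N + 1))⁻¹ := fun z => by
      rw [← div_eq_mul_inv, le_div_iff₀ (by positivity), mul_comm]
      refine (h0 z).trans (le_mul_of_one_le_left hC0 (one_le_pow₀ (by norm_num)))
    calc |u (x + y) - u x| ≤ |u (x + y)| + |u x| := abs_sub _ _
      _ ≤ _ := by linarith [hb x, hb (x + y)]

theorem measurable_fracLaplacian (s : ℝ) (u : 𝓢(EuclideanSpace ℝ (Fin N), ℝ)) :
    Measurable (fracLaplacian s u) := by
  have hu : Measurable u := u.continuous.measurable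
  refine Measurable.const_mul ?_ _
  have : Measurable fun q : EuclideanSpace ℝ (Fin N) × EuclideanSpace ℝ (Fin N) =>
      (2 * u q.1 - u (q.1 + q.2) - u (q.1 - q.2)) / ‖q.2‖ ^ ((N : ℝ) + 2 * s) := by fun_prop
  exact this.stronglyMeasurable.integral_prod_right'.measurable

/-- The second difference is a sum of two first differences, each at most `min 1 ‖y‖` times values
of `G`. Integrating in `x` first, translation invariance decouples the variables. -/
theorem integrable_fracLaplacian [NeZero N] (hγ : 0 < γ) (hγ1 : γ < 1)
    (u : 𝓢(EuclideanSpace ℝ (Fin N), ℝ)) : Integrable (fracLaplacian (γ / 2) u) := by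
  obtain ⟨G, hGm, hGi, hG0, hG⟩ := u.exists_abs_sub_le_min_one_norm
  set W : EuclideanSpace ℝ (Fin N) → ℝ := fun y => min 1 ‖y‖ / ‖y‖ ^ ((N : ℝ) + γ) with hW
  have hWi : Integrable W := integrable_min_one_norm_div_rpow hγ hγ1
  have hWm : Measurable W := by fun_prop
  have hW0 : ∀ y, 0 ≤ W y := fun y => by positivity
  set S : EuclideanSpace ℝ (Fin N) → EuclideanSpace ℝ (Fin N) → ℝ≥0∞ := fun x y =>
    ENNReal.ofReal (G x) + ENNReal.ofReal (G x) + ENNReal.ofReal (G (x + y)) +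
      ENNReal.ofReal (G (x - y)) with hS
  have hbound : ∀ x y, ‖(2 * u x - u (x + y) - u (x - y)) / ‖y‖ ^ ((N : ℝ) + 2 * (γ / 2))‖ₑ ≤
      ENNReal.ofReal (W y) * S x y := fun x y => by
    have e : S x y = ENNReal.ofReal (G x + G x + G (x + y) + G (x - y)) := by
      have := hG0 x
      have := hG0 (x + y)
      have := hG0 (x - y)
      rw [ENNReal.ofReal_add (by positivity) (by positivity),
        ENNReal.ofReal_add (by positivity) (by positivity),
        ENNReal.ofReal_add (by positivity) (by positivity)]
    rw [e, ← ENNReal.ofReal_mul (hW0 y), ← ofReal_norm]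
    refine ENNReal.ofReal_le_ofReal ?_
    rw [show (N : ℝ) + 2 * (γ / 2) = N + γ by ring, norm_div, Real.norm_eq_abs,
      Real.norm_of_nonneg (r := ‖y‖ ^ ((N : ℝ) + γ)) (by positivity), hW, div_mul_eq_mul_div]
    gcongr
    have h1 := hG x y
    have h2 := hG x (-y)
    rw [norm_neg, ← sub_eq_add_neg] at h2
    calc |2 * u x - u (x + y) - u (x - y)|
        = |(u (x + y) - u x) + (u (x - y) - u x)| := by rw [← abs_neg]; ring_nf
      _ ≤ _ := (abs_add_le _ _).trans (by linarith)
  have hSm : Measurable (Function.uncurry S) := by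
    simp only [hS, Function.uncurry_def]
    fun_prop
  have hSint : ∀ y, ∫⁻ x, S x y = 4 * ∫⁻ x, ENNReal.ofReal (G x) := fun y => by
    simp only [hS]
    rw [lintegral_add_left (by fun_prop), lintegral_add_left (by fun_prop),
      lintegral_add_left (by fun_prop), lintegral_add_right_eq_self (fun x => ENNReal.ofReal (G x)) y,
      lintegral_sub_right_eq_self (fun x => ENNReal.ofReal (G x)) y]
    ring
  refine ⟨(measurable_fracLaplacian _ u).aestronglyMeasurable, ?_⟩
  rw [hasFiniteIntegral_iff_enorm]
  calc ∫⁻ x, ‖fracLaplacian (γ / 2) u x‖ₑ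
      ≤ ∫⁻ x, ‖fracLaplacianConst N (γ / 2) / 2‖ₑ * ∫⁻ y, ENNReal.ofReal (W y) * S x y := by
        refine lintegral_mono fun x => ?_
        rw [fracLaplacian, enorm_mul]
        gcongr
        exact (enorm_integral_le_lintegral_enorm _).trans (lintegral_mono (hbound x))
    _ = ‖fracLaplacianConst N (γ / 2) / 2‖ₑ *
          ∫⁻ y, ENNReal.ofReal (W y) * (4 * ∫⁻ x, ENNReal.ofReal (G x)) := by
        rw [lintegral_const_mul' _ _ enorm_ne_top, lintegral_lintegral_swap]
        · congr 1
          refine lintegral_congr fun y => ?_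
          rw [lintegral_const_mul' _ _ ENNReal.ofReal_ne_top, hSint]
        · exact ((hWm.comp measurable_snd).ennreal_ofReal.mul hSm).aemeasurable
    _ < ⊤ := by
        have h1 : ∫⁻ x, ENNReal.ofReal (G x) < ⊤ :=
          (hasFiniteIntegral_iff_ofReal (.of_forall hG0)).1 hGi.2
        have h2 : ∫⁻ x, ENNReal.ofReal (W x) < ⊤ :=
          (hasFiniteIntegral_iff_ofReal (.of_forall hW0)).1 hWi.2
        rw [lintegral_mul_const _ (by fun_prop)]
        exact ENNReal.mul_lt_top enorm_lt_top (ENNReal.mul_lt_top h2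
          (ENNReal.mul_lt_top (by norm_num) h1))

open scoped FourierTransform in
theorem exists_abs_fracLaplacian_le [NeZero N] (hγ : 0 < γ) (hγ1 : γ < 1)
    (u : 𝓢(EuclideanSpace ℝ (Fin N), ℝ)) : ∃ B : ℝ, ∀ x, |fracLaplacian (γ / 2) u x| ≤ B := by
  obtain ⟨κ, -, hκ⟩ := exists_integral_cosKernel_eq N hγ hγ1
  refine ⟨‖((fracLaplacianConst N (γ / 2) / 2 * κ : ℝ) : ℂ)‖ *
    ∫ ξ, ‖((‖ξ‖ ^ γ : ℝ) : ℂ) * 𝓕 (schwartzOfReal u) ξ‖, fun x => ?_⟩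
  rw [← Real.norm_eq_abs, ← Complex.norm_real, fracLaplacian_eq_integral_fourier hγ hγ1 hκ, norm_mul]
  gcongr
  refine (norm_integral_le_integral_norm _).trans_eq ?_
  congr 1 with ξ
  rw [norm_mul, Complex.norm_exp_ofReal_mul_I, one_mul]

/-- Boundedness of `f` handles the singularity in the unit ball; outside it the weight is at most 1.
-/
theorem integrable_rpow_norm_mul_of_bounded [NeZero N] (hγ : 0 < γ) (hγN : γ ≤ N)
    {f : EuclideanSpace ℝ (Fin N) → ℝ} (hf : Integrable f) {B : ℝ} (hB : ∀ x, |f x| ≤ B) :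
    Integrable fun x => ‖x‖ ^ (γ - N) * f x := by
  have : Nontrivial (EuclideanSpace ℝ (Fin N)) :=
    Module.nontrivial_of_finrank_pos (R := ℝ) (by simpa using NeZero.pos N)
  have hd : (Module.finrank ℝ (EuclideanSpace ℝ (Fin N)) : ℝ) = N := by simp
  have hm : Measurable fun x : EuclideanSpace ℝ (Fin N) => ‖x‖ ^ (γ - N) := by fun_prop
  rw [← integrableOn_univ, ← Set.union_compl_self (ball (0 : EuclideanSpace ℝ (Fin N)) 1),
    integrableOn_union]
  constructor
  · obtain ⟨C, hC⟩ := setLIntegral_ball_rpow_norm_le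
      (μ := (volume : Measure (EuclideanSpace ℝ (Fin N)))) (a := γ - N) (by rw [hd]; linarith)
    have hi : IntegrableOn (fun x : EuclideanSpace ℝ (Fin N) => ‖x‖ ^ (γ - N)) (ball 0 1) :=
      ⟨hm.aestronglyMeasurable, by
        rw [hasFiniteIntegral_iff_ofReal (.of_forall fun y => by positivity)]
        exact (hC 1 one_pos).trans_lt (ENNReal.mul_lt_top ENNReal.ofReal_lt_top ENNReal.coe_lt_top)⟩
    exact Integrable.mul_bdd (c := B) hi hf.aestronglyMeasurable.restrict (.of_forall hB)
  · refine Integrable.mono (g := f) hf.integrableOn (hm.aestronglyMeasurable.mul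
      hf.aestronglyMeasurable).restrict ?_
    refine (ae_restrict_iff' measurableSet_ball.compl).2 (.of_forall fun x hx => ?_)
    have hx : 1 ≤ ‖x‖ := by simpa using hx
    rw [norm_mul, Real.norm_of_nonneg (r := ‖x‖ ^ (γ - N)) (by positivity)]
    exact mul_le_of_le_one_left (norm_nonneg _) (Real.rpow_le_one_of_one_le_of_nonpos hx (by linarith))

end FractionalLaplacianIntegrable

/-! ### Inverting the fractional Laplacian by superposing Gaussians. -/

section FractionalRepresentation

variable {N : ℕ} {γ : ℝ}

theorem integral_rpow_mul_exp_neg_mul_inv_Ioi {a r : ℝ} (ha : 0 < a) (hr : 0 < r) :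
    ∫ t in Set.Ioi (0 : ℝ), t ^ (-a - 1) * Real.exp (-(r * t⁻¹)) = (1 / r) ^ a * Real.Gamma a := by
  rw [← Real.integral_rpow_mul_exp_neg_mul_Ioi ha hr, ← integral_comp_rpow_Ioi
    (fun t => t ^ (a - 1) * Real.exp (-(r * t))) (p := -1) (by norm_num)]
  refine setIntegral_congr_fun measurableSet_Ioi fun t ht => ?_
  have ht : 0 < t := ht
  simp only [abs_neg, abs_one, one_mul, smul_eq_mul, Real.rpow_neg_one]
  rw [Real.inv_rpow ht.le, ← Real.rpow_neg ht.le, ← mul_assoc, ← Real.rpow_add ht]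
  ring_nf

/-- Fubini's theorem for a superposition of nonnegative kernels with given total mass. -/
theorem integral_Ioi_integral_mul {α : Type*} [MeasurableSpace α] {μ : Measure α} [SFinite μ]
    {k : ℝ → α → ℝ} {m : α → ℝ} {F : α → ℂ} (hk : Measurable (Function.uncurry k))
    (hk0 : ∀ t, 0 < t → ∀ x, 0 ≤ k t x) (hm0 : ∀ᵐ x ∂μ, 0 < m x)
    (hm : ∀ᵐ x ∂μ, ∫ t in Set.Ioi (0 : ℝ), k t x = m x) (hFm : AEStronglyMeasurable F μ)
    (hF : Integrable (fun x => (m x : ℂ) * F x) μ) :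
    ∫ t in Set.Ioi (0 : ℝ), ∫ x, (k t x : ℂ) * F x ∂μ = ∫ x, (m x : ℂ) * F x ∂μ := by
  have hmeas : AEStronglyMeasurable (fun q : ℝ × α => (k q.1 q.2 : ℂ) * F q.2)
      ((volume.restrict (Set.Ioi (0 : ℝ))).prod μ) :=
    (Complex.measurable_ofReal.comp hk).aestronglyMeasurable.mul hFm.comp_snd
  have hki : ∀ᵐ x ∂μ, Integrable (fun t => k t x) (volume.restrict (Set.Ioi (0 : ℝ))) := by
    filter_upwards [hm0, hm] with x h0 h1
    -- The integral of a non-integrable function is 0 by convention, so the positive value `m x`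
    -- certifies integrability.
    by_contra h
    rw [integral_undef h] at h1
    exact h0.ne h1
  have hprod : Integrable (fun q : ℝ × α => (k q.1 q.2 : ℂ) * F q.2)
      ((volume.restrict (Set.Ioi (0 : ℝ))).prod μ) := by
    refine (integrable_prod_iff' hmeas).2 ⟨?_, ?_⟩
    · filter_upwards [hki] with x hx
      exact Integrable.mul_const (Integrable.ofReal (𝕜 := ℂ) hx) _
    · refine hF.norm.congr ?_
      filter_upwards [hm0, hm] with x h0 h1
      have hn : ∫ t in Set.Ioi (0 : ℝ), ‖(k t x : ℂ) * F x‖ =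
          ∫ t in Set.Ioi (0 : ℝ), k t x * ‖F x‖ := by
        refine setIntegral_congr_fun measurableSet_Ioi fun t ht => ?_
        rw [norm_mul, Complex.norm_real, Real.norm_of_nonneg (hk0 t ht x)]
      simp only [hn]
      rw [integral_mul_const, h1, norm_mul, Complex.norm_real, Real.norm_of_nonneg h0.le]
  rw [integral_integral_swap hprod]
  refine integral_congr_ae ?_
  filter_upwards [hm] with x hx
  rw [integral_mul_const, integral_complex_ofReal, hx]

theorem one_div_pi_mul_sq_rpow {r : ℝ} (hr : 0 < r) (a : ℝ) :
    (1 / (Real.pi * r ^ 2)) ^ a = Real.pi ^ (-a) * r ^ (-(2 * a)) := by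
  have hπ := Real.pi_pos
  rw [one_div, Real.inv_rpow (by positivity), ← Real.rpow_neg (by positivity),
    Real.mul_rpow hπ.le (by positivity), ← Real.rpow_natCast, ← Real.rpow_mul hr.le]
  congr 2
  push_cast
  ring

open scoped FourierTransform in
/-- The Riesz potential inverts the fractional Laplacian on Schwartz functions, at the origin. -/
theorem exists_apply_zero_eq_integral_fracLaplacian (N : ℕ) [NeZero N] (hγ : 0 < γ) (hγ1 : γ < 1) :
    ∃ C : ℝ, ∀ u : 𝓢(EuclideanSpace ℝ (Fin N), ℝ),
      u 0 = C * ∫ x, ‖x‖ ^ (γ - N) * fracLaplacian (γ / 2) u x := by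
  have : Nontrivial (EuclideanSpace ℝ (Fin N)) :=
    Module.nontrivial_of_finrank_pos (R := ℝ) (by simpa using NeZero.pos N)
  have hN : (1 : ℝ) ≤ N := by exact_mod_cast NeZero.one_le
  obtain ⟨κ, hκ0, hκ⟩ := exists_integral_cosKernel_eq N hγ hγ1
  set c := fracLaplacianConst N (γ / 2) / 2 * κ with hc
  have hc0 : 0 < c := mul_pos (half_pos (fracLaplacianConst_pos hγ hγ1)) hκ0
  -- Chosen so that integrating `exp (-π * ‖x‖ ^ 2 * t)` against `t ^ (a - 1)` gives a multiple of
  -- `‖x‖ ^ (-2 * a) = ‖x‖ ^ (γ - N)`.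
  set a : ℝ := (N - γ) / 2 with ha
  have ha0 : 0 < a := by rw [ha]; linarith
  have hb0 : 0 < γ / 2 := by linarith
  set A₁ := Real.pi ^ (-a) * Real.Gamma a with hA₁
  set A₂ := Real.pi ^ (-(γ / 2)) * Real.Gamma (γ / 2) with hA₂
  have hA₁0 : 0 < A₁ := mul_pos (Real.rpow_pos_of_pos Real.pi_pos _) (Real.Gamma_pos_of_pos ha0)
  have hA₂0 : 0 < A₂ := mul_pos (Real.rpow_pos_of_pos Real.pi_pos _) (Real.Gamma_pos_of_pos hb0)
  have hne : ∀ᵐ x : EuclideanSpace ℝ (Fin N), 0 < ‖x‖ := by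
    have h0 : ∀ᵐ y : EuclideanSpace ℝ (Fin N), y ≠ 0 := compl_mem_ae_iff.2 (measure_singleton 0)
    exact h0.mono fun x hx => norm_pos_iff.2 hx
  refine ⟨A₁ / (c * A₂), fun u => ?_⟩
  set f := fracLaplacian (γ / 2) u with hf
  have hfi : Integrable f := integrable_fracLaplacian hγ hγ1 u
  obtain ⟨B, hB⟩ := exists_abs_fracLaplacian_le hγ hγ1 u
  have hfw : Integrable fun x => ‖x‖ ^ (γ - N) * f x :=
    integrable_rpow_norm_mul_of_bounded hγ (by linarith) hfi hB
  set V := 𝓕 (schwartzOfReal u) with hV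
  set h : EuclideanSpace ℝ (Fin N) → ℂ := fun ξ => ((‖ξ‖ ^ γ : ℝ) : ℂ) * V ξ with hh
  have hhi : Integrable h := integrable_rpow_norm_mul V hγ hγ1
  have hleft := integral_Ioi_integral_mul (μ := (volume : Measure (EuclideanSpace ℝ (Fin N))))
    (k := fun t x => t ^ (a - 1) * Real.exp (-(Real.pi * ‖x‖ ^ 2 * t)))
    (m := fun x => A₁ * ‖x‖ ^ (γ - N)) (F := fun x => (f x : ℂ))
    (by simp only [Function.uncurry_def]; fun_prop)
    (fun t ht x => by positivity)
    (hne.mono fun x hx => by positivity)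
    (hne.mono fun x hx => by
      rw [Real.integral_rpow_mul_exp_neg_mul_Ioi ha0 (by positivity), one_div_pi_mul_sq_rpow hx,
        show -(2 * a) = γ - N by rw [ha]; ring, hA₁]
      ring)
    hfi.ofReal.aestronglyMeasurable
    ((Integrable.ofReal (𝕜 := ℂ) (hfw.const_mul A₁)).congr (.of_forall fun x => by
      simp only [Complex.coe_algebraMap]
      push_cast; ring))
  have hright := integral_Ioi_integral_mul (μ := (volume : Measure (EuclideanSpace ℝ (Fin N))))
    (k := fun t ξ => t ^ (-(γ / 2) - 1) * Real.exp (-(Real.pi * ‖ξ‖ ^ 2 * t⁻¹)))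
    (m := fun ξ => A₂ * ‖ξ‖ ^ (-γ)) (F := h)
    (by simp only [Function.uncurry_def]; fun_prop)
    (fun t ht x => by positivity)
    (hne.mono fun x hx => by positivity)
    (hne.mono fun x hx => by
      rw [integral_rpow_mul_exp_neg_mul_inv_Ioi hb0 (by positivity), one_div_pi_mul_sq_rpow hx,
        show -(2 * (γ / 2)) = -γ by ring, hA₂]
      ring)
    hhi.aestronglyMeasurable
    ((V.integrable.const_mul (A₂ : ℂ)).congr (hne.mono fun ξ hξ => by
      simp only [hh]
      rw [← mul_assoc, ← Complex.ofReal_mul, mul_assoc, ← Real.rpow_add hξ]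
      simp))
  have hrightV : ∫ ξ, ((A₂ * ‖ξ‖ ^ (-γ) : ℝ) : ℂ) * h ξ = A₂ * u 0 := by
    have h0 := (schwartzOfReal u).eq_integral_exp_mul_fourier 0
    simp only [inner_zero_right, mul_zero, Complex.ofReal_zero, zero_mul, Complex.exp_zero,
      one_mul, schwartzOfReal_apply] at h0
    rw [h0, ← integral_const_mul]
    refine integral_congr_ae (hne.mono fun ξ hξ => ?_)
    simp only [hh]
    rw [← mul_assoc, ← Complex.ofReal_mul, mul_assoc, ← Real.rpow_add hξ]
    simp [hV]
  have hleftV : ∫ x, ((A₁ * ‖x‖ ^ (γ - N) : ℝ) : ℂ) * (f x : ℂ) =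
      ((A₁ * ∫ x, ‖x‖ ^ (γ - N) * f x : ℝ) : ℂ) := by
    rw [← integral_const_mul, ← integral_complex_ofReal]
    congr 1 with x
    push_cast
    ring
  -- The transformed Gaussian brings `t ^ (-N / 2)`, turning `t ^ (a - 1)` into `t ^ (-γ / 2 - 1)`,
  -- the weight that produces `‖ξ‖ ^ (-γ)`.
  have hlink : ∫ t in Set.Ioi (0 : ℝ), ∫ x,
      ((t ^ (a - 1) * Real.exp (-(Real.pi * ‖x‖ ^ 2 * t)) : ℝ) : ℂ) * (f x : ℂ) =
      (c : ℂ) * ∫ t in Set.Ioi (0 : ℝ), ∫ ξ,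
      ((t ^ (-(γ / 2) - 1) * Real.exp (-(Real.pi * ‖ξ‖ ^ 2 * t⁻¹)) : ℝ) : ℂ) * h ξ := by
    rw [← integral_const_mul]
    refine setIntegral_congr_fun measurableSet_Ioi fun t ht => ?_
    have ht : 0 < t := ht
    have hg := integral_gaussian_mul_fracLaplacian hγ hγ1 hκ u ht
    calc _ = ((t ^ (a - 1) : ℝ) : ℂ) *
          ∫ x, ((Real.exp (-(Real.pi * ‖x‖ ^ 2 * t)) * f x : ℝ) : ℂ) := by
          rw [← integral_const_mul]
          congr 1 with x
          push_cast
          ring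
      _ = _ := by
          rw [hg, mul_left_comm, ← integral_const_mul]
          congr 2 with ξ
          have e : t ^ (-(γ / 2) - 1) = t ^ (a - 1) * t ^ (-((N : ℝ) / 2)) := by
            rw [← Real.rpow_add ht, ha]; ring_nf
          rw [e]
          simp only [Complex.ofReal_mul, hh, hV]
          ring
  rw [hleft, hright, hrightV, hleftV] at hlink
  have hreal : A₁ * ∫ x, ‖x‖ ^ (γ - N) * f x = c * (A₂ * u 0) := by exact_mod_cast hlink
  rw [div_mul_eq_mul_div, hreal]
  field_simp

theorem fracLaplacian_comp_add (s : ℝ) (u : EuclideanSpace ℝ (Fin N) → ℝ)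
    (x y : EuclideanSpace ℝ (Fin N)) :
    fracLaplacian s (fun z => u (z + x)) y = fracLaplacian s u (y + x) := by
  simp only [fracLaplacian, add_right_comm y _ x, ← add_sub_right_comm]

/-- A Schwartz function is dominated by the Riesz potential of its fractional Laplacian. -/
theorem exists_enorm_le_rieszPotential_fracLaplacian (N : ℕ) [NeZero N] (hγ : 0 < γ)
    (hγ1 : γ < 1) :
    ∃ K : ℝ≥0, ∀ (u : 𝓢(EuclideanSpace ℝ (Fin N), ℝ)) (x : EuclideanSpace ℝ (Fin N)),
      ‖u x‖ₑ ≤ K * ∫⁻ y, ENNReal.ofReal (‖x - y‖ ^ (γ - N)) * ‖fracLaplacian (γ / 2) u y‖ₑ := by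
  obtain ⟨C, hC⟩ := exists_apply_zero_eq_integral_fracLaplacian N hγ hγ1
  refine ⟨‖C‖₊, fun u x => ?_⟩
  -- The formula at the origin is applied to the translate `z ↦ u (z + x)`.
  set v := SchwartzMap.compSubConstCLM ℝ (-x) u with hv
  have hvx : ∀ z, v z = u (z + x) := fun z => by
    rw [hv, SchwartzMap.compSubConstCLM_apply, sub_neg_eq_add]
  have hfv : ∀ y, fracLaplacian (γ / 2) v y = fracLaplacian (γ / 2) u (y + x) := fun y => by
    rw [← fracLaplacian_comp_add]
    congr 1 with z
    exact hvx z
  have h0 : u x = C * ∫ y, ‖y‖ ^ (γ - N) * fracLaplacian (γ / 2) u (y + x) := by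
    have := hC v
    simp only [hvx, hfv, zero_add] at this
    exact this
  rw [h0, enorm_mul]
  gcongr
  · exact le_rfl
  refine (enorm_integral_le_lintegral_enorm _).trans_eq ?_
  refine Eq.trans ?_ (lintegral_add_right_eq_self _ x)
  refine lintegral_congr fun y => ?_
  rw [enorm_mul, Real.enorm_of_nonneg (by positivity), norm_sub_rev, add_sub_cancel_right]

theorem exists_weighted_fractional_hardy_morrey (N : ℕ) {p α β lam : ℝ} (hp : 1 < p)
    (hα : α < N / Real.conjExponent p) (hβ : β < (N - lam) / p) (hαβ : α + β = γ)
    (hγ : 0 < γ) (hγ1 : γ < 1) (hlam : 0 < lam) (hlam' : lam < N) :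
    ∃ C : ℝ≥0, 0 < C ∧ ∀ u : 𝓢(EuclideanSpace ℝ (Fin N), ℝ),
      MemMorrey p lam (fun x => ‖x‖ ^ α * fracLaplacian (γ / 2) u x) →
      MemMorrey p lam (fun x => ‖x‖ ^ (-β) * u x) ∧
        eMorreyNorm p lam (fun x => ‖x‖ ^ (-β) * u x) ≤
          C * eMorreyNorm p lam (fun x => ‖x‖ ^ α * fracLaplacian (γ / 2) u x) := by
  have : NeZero N := ⟨by rintro rfl; norm_num at hlam'; linarith⟩
  obtain ⟨K, hK⟩ := exists_enorm_le_rieszPotential_fracLaplacian N hγ hγ1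
  obtain ⟨C, hC0, hC⟩ := exists_hardy_of_le_rieszPotential (N := N) (F := ℝ) hp hα hβ hαβ hγ
    hlam hlam' K
  exact ⟨C, hC0, fun u hu => hC u _ u.continuous.aestronglyMeasurable (.of_forall (hK u)) hu⟩

theorem exists_fractional_hardy_morrey (N : ℕ) {p lam : ℝ} (hp : 1 < p) (hγ : 0 < γ)
    (hγ1 : γ < 1) (hlam : 0 < lam) (hlam' : lam < N - γ * p) :
    ∃ C : ℝ≥0, 0 < C ∧ ∀ u : 𝓢(EuclideanSpace ℝ (Fin N), ℝ),
      MemMorrey p lam (fun x => fracLaplacian (γ / 2) u x) →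
      MemMorrey p lam (fun x => ‖x‖ ^ (-γ) * u x) ∧
        eMorreyNorm p lam (fun x => ‖x‖ ^ (-γ) * u x) ≤
          C * eMorreyNorm p lam (fun x => fracLaplacian (γ / 2) u x) := by
  have hpc : 0 < Real.conjExponent p := (Real.HolderConjugate.conjExponent hp).symm.pos
  have hp0 : 0 < p := by linarith
  have hγp : 0 < γ * p := by positivity
  have hN : (0 : ℝ) < N := by linarith
  simpa using exists_weighted_fractional_hardy_morrey N (α := 0) (β := γ) hp (by positivity)
    (by rw [lt_div_iff₀ hp0]; linarith) (zero_add γ) hγ hγ1 hlam (by linarith)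

end FractionalRepresentation

theorem theorem5p9 (N : ℕ) :
    -- weighted Hardy inequality
    (∀ p α β lam : ℝ, 1 < p → α < N / Real.conjExponent p → β < (N - lam) / p → α + β = 1 →
      0 < lam → lam < min (N : ℝ) (N - β * p) →
      ∃ C : ℝ≥0, 0 < C ∧
        ∀ (u : EuclideanSpace ℝ (Fin N) → ℝ)
          (g : EuclideanSpace ℝ (Fin N) → EuclideanSpace ℝ (Fin N)),
          HasWeakGradient u g → VanishesInMean u →
          MemMorrey p lam (fun x => ‖x‖ ^ α • g x) →
          MemMorrey p lam (fun x => u x / ‖x‖ ^ β) ∧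
            eMorreyNorm p lam (fun x => u x / ‖x‖ ^ β) ≤
              C * eMorreyNorm p lam (fun x => ‖x‖ ^ α • g x)) ∧
    -- classical Hardy inequality
    (∀ p lam : ℝ, 1 < p → p < N → 0 < lam → lam < N - p →
      ∃ C : ℝ≥0, 0 < C ∧
        ∀ (u : EuclideanSpace ℝ (Fin N) → ℝ)
          (g : EuclideanSpace ℝ (Fin N) → EuclideanSpace ℝ (Fin N)),
          HasWeakGradient u g → VanishesInMean u →
          MemMorrey p lam g →
          MemMorrey p lam (fun x => u x / ‖x‖) ∧
            eMorreyNorm p lam (fun x => u x / ‖x‖) ≤ C * eMorreyNorm p lam g) ∧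
    -- weighted fractional Hardy inequality
    (∀ p α β γ lam : ℝ, 1 < p → α < N / Real.conjExponent p → β < (N - lam) / p → α + β = γ →
      0 < γ → γ < 1 → 0 < lam → lam < min (N : ℝ) (N - β * p) →
      ∃ C : ℝ≥0, 0 < C ∧
        ∀ u : 𝓢(EuclideanSpace ℝ (Fin N), ℝ),
          MemMorrey p lam (fun x => ‖x‖ ^ α * fracLaplacian (γ / 2) u x) →
          MemMorrey p lam (fun x => ‖x‖ ^ (-β) * u x) ∧
            eMorreyNorm p lam (fun x => ‖x‖ ^ (-β) * u x) ≤
              C * eMorreyNorm p lam (fun x => ‖x‖ ^ α * fracLaplacian (γ / 2) u x)) ∧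
    -- classical fractional Hardy inequality
    (∀ p γ lam : ℝ, 1 < p → 0 < γ → γ < 1 → γ * p < N → 0 < lam → lam < N - γ * p →
      ∃ C : ℝ≥0, 0 < C ∧
        ∀ u : 𝓢(EuclideanSpace ℝ (Fin N), ℝ),
          MemMorrey p lam (fun x => fracLaplacian (γ / 2) u x) →
          MemMorrey p lam (fun x => ‖x‖ ^ (-γ) * u x) ∧
            eMorreyNorm p lam (fun x => ‖x‖ ^ (-γ) * u x) ≤
              C * eMorreyNorm p lam (fun x => fracLaplacian (γ / 2) u x)) := by
  -- For `p > 0`, `lam < N - β * p` says the same as `β < (N - lam) / p`, so `lam < N` is what the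
  -- minimum adds.
  exact ⟨fun _ _ _ _ hp hα hβ hαβ hlam hlam' =>
      exists_weighted_hardy_morrey N hp hα hβ hαβ hlam (hlam'.trans_le (min_le_left _ _)),
    fun _ _ hp _ hlam hlam' => exists_hardy_morrey N hp hlam hlam',
    fun _ _ _ _ _ hp hα hβ hαβ hγ hγ1 hlam hlam' =>
      exists_weighted_fractional_hardy_morrey N hp hα hβ hαβ hγ hγ1 hlam
        (hlam'.trans_le (min_le_left _ _)),
    fun _ _ _ hp hγ hγ1 _ hlam hlam' => exists_fractional_hardy_morrey N hp hγ hγ1 hlam hlam'⟩
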